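/- **Setting.** A *set system* of a finite universe $U$ is a family $\mathcal F\subseteq 2^U$; it is *monotone* if $U\in\mathcal F$ and every superset (within $U$) of a member of $\mathcal F$ is in $\mathcal F$. For a real $\ell\ge 0$, a set $S\subseteq U$ is an *$\ell$-extension* of $X\subseteq U$ if $X\cup S\in\mathcal F$ and $|S|\le \ell$. For $\alpha\ge 1$, a *random $\alpha$-extension oracle* for $U$ and a monotone $\mathcal F$ is a function $\mathcal O:2^U\times\mathbb N\times\{0,1\}^m\to 2^U$, for some $m\in\mathbb N$, such that $\mathcal O(X,\ell,r)\cup X\in\mathcal F$ for all $(X,\ell,r)$ and, whenever $X$ has an $\ell$-extension, $\mathcal O(X,\ell,r)$ is an $(\alpha\ell)$-extension of $X$ for at least half of all $r\in\{0,1\}^m$. Consider randomized algorithms (random access programs that can flip fair coins) which are given $U$ and can access a monotone set system $\mathcal F$ of $U$ only by querying a random $\alpha$-extension oracle, each query $(X,\ell)$ being made with a fresh uniformly random bit string $r$. For $c\ge 1$, the *cost* of an execution is the number of computational operations plus the sum of $c^{\ell}$ over all queries $(X,\ell)$ made. An algorithm has cost at most $f:\mathbb N\to\mathbb R$ if, for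 every $n$ and all inputs with $|U|\le n$, every execution has cost at most $f(n)$. For $\beta\ge 1$, an algorithm is a *(randomized) $\beta$-approximation* if, for every $U$, every monotone $\mathcal F$ and every random $\alpha$-extension oracle for them, it returns a member of $\mathcal F$ with probability $1$, and with probability at least $\frac12$ the returned set $S$ satisfies $|S|\le\beta\cdot\min_{T\in\mathcal F}|T|$. Let $\mathrm{best}(\alpha,c,\beta)$ be the infimum of all real $d\ge 1$ for which there is a $\beta$-approximation of cost at most $d^n\cdot n^{O(1)}$ (that is, at most $d^n\cdot C(n+1)^k$ for some constants $C,k$), where the infimum of the empty set is $+\infty$. For $\beta,c>1$, let $\mathrm{amls}_{\mathrm{ESA}}(\beta,c)$ be the unique $d\in\left(1,\,1+\frac{c-1}{\beta}\right)$ with $$D\!\left(\tfrac1\beta\,\Big\|\,\tfrac{d-1}{c-1}\right)=\frac{\ln c}{\beta},\qquad D(a\|b)=a\ln\frac ab+(1-a)\ln\frac{1-a}{1-b}.$$ **Lemma.** For every $\beta>\alpha\ge 1$ and every $c>1$, the number $\mathrm{amls}_{\mathrm{ESA}}(\beta,c)$ is well defined (there is exactly one such $d$), and $$\mathrm{best}(\alpha,c,\beta)<\mathrm{amls}_{\mathrm{ESA}}(\beta,c).$$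 -/

import Mathlib

noncomputable section

namespace SubsetMin

/-! Set systems over the universe `Fin n`, extensions, and random extension oracles. -/

/-- A monotone set system: it contains the universe and is closed under supersets. -/
structure IsMonotoneSystem {n : ℕ} (F : Set (Finset (Fin n))) : Prop where
  univ_mem : Finset.univ ∈ F
  superset_mem : ∀ S T : Finset (Fin n), S ⊆ T → S ∈ F → T ∈ F

/-- `S` is an `ℓ`-extension of `X` with respect to `F` (`ℓ` may be real, as in `α * ℓ`). -/
def IsExtension {n : ℕ} (F : Set (Finset (Fin n))) (ℓ : ℝ) (X S : Finset (Fin n)) : Prop :=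
  X ∪ S ∈ F ∧ (S.card : ℝ) ≤ ℓ

/-- A function `2^U × ℕ × {0,1}^m → 2^U`, for some `m`. -/
structure Oracle (n : ℕ) where
  m : ℕ
  answer : Finset (Fin n) → ℕ → (Fin m → Bool) → Finset (Fin n)

/-- `O` is a random `α`-extension oracle for the set system `F`. -/
structure IsExtensionOracle {n : ℕ} (F : Set (Finset (Fin n))) (α : ℝ) (O : Oracle n) : Prop where
  mem : ∀ (X : Finset (Fin n)) (ℓ : ℕ) (r : Fin O.m → Bool), O.answer X ℓ r ∪ X ∈ F
  half : ∀ (X : Finset (Fin n)) (ℓ : ℕ), (∃ S, IsExtension F (ℓ : ℝ) X S) →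
    (1 / 2 : ℝ) * (Fintype.card (Fin O.m → Bool) : ℝ) ≤
      (Set.ncard {r : Fin O.m → Bool | IsExtension F (α * (ℓ : ℝ)) X (O.answer X ℓ r)} : ℝ)

/-! The machine model: randomized random access programs with extension oracles.  A program has
registers and random access arrays, all holding natural numbers, and is written once and for all
(it does not depend on `n`). -/

/-- Programs over the specification list `L`; the oracles are indexed by the pairs
`(α, c) ∈ L`.  Registers and arrays are named by natural numbers. -/
inductive Prog (L : Finset (ℝ × ℝ)) : Type
  /-- do nothing -/
  | skip : Prog L
  /-- `x := k`, for a numerical constant `k` -/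
  | const (x k : ℕ) : Prog L
  /-- `x := y` -/
  | copy (x y : ℕ) : Prog L
  /-- `x := y + z` -/
  | add (x y z : ℕ) : Prog L
  /-- `x := max (y - z) 0` -/
  | sub (x y z : ℕ) : Prog L
  /-- `x := a[i]`, where `i` is a register -/
  | load (x a i : ℕ) : Prog L
  /-- `a[i] := x`, where `i` is a register -/
  | store (a i x : ℕ) : Prog L
  /-- `x :=` a uniformly random bit -/
  | flip (x : ℕ) : Prog L
  /-- query the oracle `p` on the set stored in array `a` and the number in register `l`;
  the answer is written to array `b` -/
  | query (p : L) (a l b : ℕ) : Prog L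
  /-- sequential composition -/
  | seq (P Q : Prog L) : Prog L
  /-- `if x ≠ 0 then P else Q` -/
  | ite (x : ℕ) (P Q : Prog L) : Prog L
  /-- `while x ≠ 0 do P` -/
  | loop (x : ℕ) (P : Prog L) : Prog L

/-- Contents of the memory, together with the cost incurred so far. -/
structure State where
  reg : ℕ → ℕ
  arr : ℕ → ℕ → ℕ
  cost : ℝ

namespace State

/-- Add `q` to the cost incurred so far. -/
def pay (s : State) (q : ℝ) : State := { s with cost := s.cost + q }

def setReg (s : State) (x v : ℕ) : State := { s with reg := Function.update s.reg x v }

def setArr (s : State) (a : ℕ) (v : ℕ → ℕ) : State := { s with arr := Function.update s.arr a v }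

/-- The subset of the universe that array `a` represents: the indices of its nonzero cells. -/
def getSet (s : State) (n a : ℕ) : Finset (Fin n) :=
  Finset.univ.filter fun i => s.arr a i ≠ 0

/-- Write the characteristic vector of `Y` to array `a`. -/
def putSet {n : ℕ} (s : State) (a : ℕ) (Y : Finset (Fin n)) : State :=
  s.setArr a fun i => if i ∈ Y.image (fun j : Fin n => (j : ℕ)) then 1 else 0

/-- Before the execution: register `0` holds the size of the universe, all else is `0`. -/
def init (n : ℕ) : State :=
  { reg := Function.update (fun _ => 0) 0 n, arr := fun _ _ => 0, cost := 0 }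

/-- The set returned by a program: the one represented by array `0` when it stops. -/
def output (s : State) (n : ℕ) : Finset (Fin n) := s.getSet n 0

end State

/-- Sequencing of random computations; `none` means that the computation was cut off. -/
def andThen (μ : PMF (Option State)) (f : State → PMF (Option State)) : PMF (Option State) :=
  μ.bind fun o => match o with
    | none => PMF.pure none
    | some s => f s

/-- `while x ≠ 0` with the given body; each test costs `1`.  The computation is cut off when the
test has been made `fuel` times without leaving the loop. -/
def runLoop (x : ℕ) (body : State → PMF (Option State)) : ℕ → State → PMF (Option State)
  | 0, _ => PMF.pure none
  | fuel + 1, s =>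
    if s.reg x = 0 then PMF.pure (some (s.pay 1))
    else andThen (body (s.pay 1)) (runLoop x body fuel)

/-- The distribution of the final state of a program that is started in a given state with the
oracles `O`, where an execution that makes `fuel` tests in a row within one loop without leaving
it is cut off.  Every operation costs `1`, a query `(X, ℓ)` to the oracle of `(α, c)` costs
`c ^ ℓ`, and every query is made with a fresh uniformly random bit string. -/
def Prog.run {L : Finset (ℝ × ℝ)} {n : ℕ} (O : L → Oracle n) (fuel : ℕ) :
    Prog L → State → PMF (Option State)
  | .skip, s => PMF.pure (some s)
  | .const x k, s => PMF.pure (some ((s.setReg x k).pay 1))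
  | .copy x y, s => PMF.pure (some ((s.setReg x (s.reg y)).pay 1))
  | .add x y z, s => PMF.pure (some ((s.setReg x (s.reg y + s.reg z)).pay 1))
  | .sub x y z, s => PMF.pure (some ((s.setReg x (s.reg y - s.reg z)).pay 1))
  | .load x a i, s => PMF.pure (some ((s.setReg x (s.arr a (s.reg i))).pay 1))
  | .store a i x, s =>
    PMF.pure (some ((s.setArr a (Function.update (s.arr a) (s.reg i) (s.reg x))).pay 1))
  | .flip x, s =>
    (PMF.uniformOfFintype Bool).bind fun b =>
      PMF.pure (some ((s.setReg x (if b then 1 else 0)).pay 1))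
  | .query p a l b, s =>
    (PMF.uniformOfFintype (Fin (O p).m → Bool)).bind fun r =>
      PMF.pure (some
        ((s.putSet b ((O p).answer (s.getSet n a) (s.reg l) r)).pay (p.1.2 ^ s.reg l)))
  | .seq P Q, s => andThen (P.run O fuel s) (Q.run O fuel)
  | .ite x P Q, s => if s.reg x ≠ 0 then P.run O fuel (s.pay 1) else Q.run O fuel (s.pay 1)
  | .loop x P, s => runLoop x (P.run O fuel) fuel s

/-- The probability that `A`, given the universe `Fin n` and the oracles `O`, stops and returns a
set with property `E` (the probabilities for bounded `fuel` increase to it). -/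
def Prog.prob {L : Finset (ℝ × ℝ)} {n : ℕ} (A : Prog L) (O : L → Oracle n)
    (E : Finset (Fin n) → Prop) : ENNReal :=
  ⨆ fuel : ℕ, (A.run O fuel (State.init n)).toOuterMeasure
    {o | ∃ s : State, o = some s ∧ E (s.output n)}

/-- Every execution of `A` on the universe `Fin n` with the oracles `O` stops and has cost at most
`B`. -/
def Prog.CostAtMost {L : Finset (ℝ × ℝ)} {n : ℕ} (A : Prog L) (O : L → Oracle n) (B : ℝ) : Prop :=
  ∃ fuel : ℕ, ∀ o ∈ (A.run O fuel (State.init n)).support,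
    ∃ s : State, o = some s ∧ s.cost ≤ B

/-- `O` provides an `α`-extension oracle for `F`, for every `(α, c) ∈ L`. -/
def AreExtensionOracles {L : Finset (ℝ × ℝ)} {n : ℕ} (F : Set (Finset (Fin n)))
    (O : L → Oracle n) : Prop :=
  ∀ p : L, IsExtensionOracle F p.1.1 (O p)

/-- `A` is a randomized `β`-approximation for the `L`-subset minimization problem. -/
def Prog.IsApprox {L : Finset (ℝ × ℝ)} (A : Prog L) (β : ℝ) : Prop :=
  ∀ (n : ℕ) (F : Set (Finset (Fin n))) (O : L → Oracle n),
    IsMonotoneSystem F → AreExtensionOracles F O →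
      A.prob O (fun S => S ∈ F) = 1 ∧
      1 / 2 ≤ A.prob O (fun S => ∀ T ∈ F, (S.card : ℝ) ≤ β * (T.card : ℝ))

/-- `A` has cost at most `f`: on all inputs with a universe of size at most `n`, every execution
has cost at most `f n`. -/
def Prog.HasCost {L : Finset (ℝ × ℝ)} (A : Prog L) (f : ℕ → ℝ) : Prop :=
  ∀ (n N : ℕ), N ≤ n → ∀ (F : Set (Finset (Fin N))) (O : L → Oracle N),
    IsMonotoneSystem F → AreExtensionOracles F O → A.CostAtMost O (f n)

/-- The infimum of all `d ≥ 1` such that there is a randomized `β`-approximation for the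
`L`-subset minimization problem with cost `d ^ n * n ^ O(1)`; it is `⊤` if there is no such `d`. -/
def bestOfList (L : Finset (ℝ × ℝ)) (β : ℝ) : EReal :=
  sInf {e : EReal | ∃ d : ℝ, e = (d : EReal) ∧ 1 ≤ d ∧ ∃ A : Prog L, A.IsApprox β ∧
    ∃ C k : ℕ, A.HasCost fun n => d ^ n * ((C : ℝ) * ((n : ℝ) + 1) ^ k)}

/-- The case of a single oracle, with approximation ratio `α` and cost `c`. -/
def best (α c β : ℝ) : EReal := bestOfList {(α, c)} β

/-! The benchmark. -/

/-- The Kullback-Leibler divergence of Bernoulli distributions with parameters `a` and `b`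
(for `0 < a, b < 1`). -/
def klBernoulli (a b : ℝ) : ℝ :=
  a * Real.log (a / b) + (1 - a) * Real.log ((1 - a) / (1 - b))

/-- The conditions that determine the number `d = amls_ESA(β, c)`. -/
def IsAmlsESA (β c d : ℝ) : Prop :=
  d ∈ Set.Ioo 1 (1 + (c - 1) / β) ∧ klBernoulli (1 / β) ((d - 1) / (c - 1)) = Real.log c / β

end SubsetMin

end

/-! The algorithm is monotone local search. Let T be a smallest solution, k = |T| and κ = k/n. A set
X is sampled, every element independently with probability p; the oracle is asked to extend X with
length l; the union is kept if it is smaller than the best set so far, which at the start is the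
universe. Suppose that X contains about q₁k elements of T and q₂(n-k) others, and that l ≈ vn. If v
> κ(1-q₁), then T \ X is an l-extension of X. If κq₁ + (1-κ)q₂ + αv < βκ, then a good answer of the
oracle yields a set of at most βk elements. Up to polynomial factors, such an X has probability
exp(-n(κD(q₁‖p) + (1-κ)D(q₂‖p))) (`exp_le_binomial`). Repeating the trial often enough therefore
costs exp(n · rate), where rate = v ln c + κD(q₁‖p) + (1-κ)D(q₂‖p).

Put a = 1/β and u = (d-1)/(c-1), so that D(a‖u) = a ln c. For u < κ < a write κ = ta + (1-t)u and
take p = t, κq₁ = ta, (1-κ)q₂ = t(1-a), v = (1-t)u. The equation for u turns the rate into ln d -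
D(κ‖cu/d), which is at most ln d (`rate_le`). The result has size t + α(1-t)u, relative to n,
whereas βκ = t + β(1-t)u is allowed. As α < β, there is room for more elements outside T, and since
q₂ < t, raising q₂ makes the sample exponentially more likely. So the rate falls strictly below ln d
(`exists_covered_nhds_of_mem_Ioo`).

The remaining proportions are easier. For κ up to some r > u it suffices to extend the empty set,
because c^u < d. For κ ≥ a the universe is good enough, and just below a one samples almost
everything. Strict inequalities persist near κ, so by compactness finitely many strategies serve all
large n (`exists_strategies`), and small n are handled by guessing. Each strategy has exponential
base strictly below d, hence so has their finite maximum D, and best ≤ D < d.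

The number d exists and is unique because D(a‖·) is continuous and strictly decreasing on (0, a],
large near 0 and zero at a.

For programs, `Safe` controls all outcomes (termination, cost, membership) and `expect` bounds the
probability of failure. -/

noncomputable section

namespace SubsetMin

/-! ### Rules for sure outcomes and for expectations of random computations. -/

/-- Every outcome of the computation is a regular end in a state with property `Q`. -/
def Safe (μ : PMF (Option State)) (Q : State → Prop) : Prop :=
  ∀ o ∈ μ.support, ∃ s, o = some s ∧ Q s

/-- The expected value of `g` in the final state, where a cut off computation counts `1`. -/
def expect (μ : PMF (Option State)) (g : State → ENNReal) : ENNReal :=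
  ∑' o, μ o * o.elim 1 g

theorem Safe.mono {μ : PMF (Option State)} {Q R : State → Prop} (h : Safe μ Q)
    (hQR : ∀ s, Q s → R s) : Safe μ R := fun o ho => by
  obtain ⟨s, rfl, hs⟩ := h o ho
  exact ⟨s, rfl, hQR s hs⟩

@[simp] theorem safe_pure {s : State} {Q : State → Prop} :
    Safe (PMF.pure (some s)) Q ↔ Q s := by
  simp [Safe]

theorem safe_bind {A : Type*} {ν : PMF A} {f : A → PMF (Option State)} {Q : State → Prop}
    (h : ∀ a, Safe (f a) Q) : Safe (ν.bind f) Q := fun o ho => by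
  obtain ⟨a, -, ha⟩ := (PMF.mem_support_bind_iff _ _ _).1 ho
  exact h a o ha

theorem Safe.andThen {μ : PMF (Option State)} {f : State → PMF (Option State)}
    {Q R : State → Prop} (h : Safe μ Q) (hf : ∀ s, Q s → Safe (f s) R) :
    Safe (andThen μ f) R := fun o ho => by
  obtain ⟨a, ha, hao⟩ := (PMF.mem_support_bind_iff _ _ _).1 ho
  obtain ⟨s, rfl, hs⟩ := h a ha
  exact hf s hs o hao

@[simp] theorem andThen_pure_some (s : State) (f : State → PMF (Option State)) :
    andThen (PMF.pure (some s)) f = f s := by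
  simp [SubsetMin.andThen]

@[simp] theorem expect_pure (s : State) (g : State → ENNReal) :
    expect (PMF.pure (some s)) g = g s := by
  unfold expect
  rw [tsum_eq_single (some s)]
  · simp
  · intro o ho
    simp [ho]

theorem expect_bind {A : Type*} (ν : PMF A) (f : A → PMF (Option State)) (g : State → ENNReal) :
    expect (ν.bind f) g = ∑' a, ν a * expect (f a) g := by
  simp only [expect, PMF.bind_apply, ← ENNReal.tsum_mul_right, ← ENNReal.tsum_mul_left]
  rw [ENNReal.tsum_comm]
  simp only [mul_assoc]

theorem expect_andThen (μ : PMF (Option State)) (f : State → PMF (Option State))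
    (g : State → ENNReal) :
    expect (andThen μ f) g = expect μ fun s => expect (f s) g := by
  rw [SubsetMin.andThen, expect_bind]
  refine tsum_congr fun o => ?_
  cases o with
  | some s => rfl
  | none =>
    congr 1
    unfold expect
    rw [tsum_eq_single none]
    · simp
    · intro o ho
      simp [ho]

theorem Safe.expect_mono {μ : PMF (Option State)} {Q : State → Prop} (h : Safe μ Q)
    {g g' : State → ENNReal} (hg : ∀ s, Q s → g s ≤ g' s) : expect μ g ≤ expect μ g' := by
  refine ENNReal.tsum_le_tsum fun o => ?_
  by_cases ho : o ∈ μ.support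
  · obtain ⟨s, rfl, hs⟩ := h o ho
    exact mul_le_mul_right (hg s hs) _
  · simp [(PMF.apply_eq_zero_iff μ o).2 ho]

theorem Safe.expect_le {μ : PMF (Option State)} {Q : State → Prop} (h : Safe μ Q)
    {g : State → ENNReal} {y : ENNReal} (hg : ∀ s, Q s → g s ≤ y) : expect μ g ≤ y := by
  calc expect μ g ≤ ∑' o, μ o * y := by
        refine ENNReal.tsum_le_tsum fun o => ?_
        by_cases ho : o ∈ μ.support
        · obtain ⟨s, rfl, hs⟩ := h o ho
          exact mul_le_mul_right (hg s hs) _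
        · simp [(PMF.apply_eq_zero_iff μ o).2 ho]
    _ = y := by rw [ENNReal.tsum_mul_right, μ.tsum_coe, one_mul]

/-- A cut-off outcome counts 1 whatever `g` is, so homogeneity relies on there being none. -/
theorem Safe.expect_const_mul {μ : PMF (Option State)} {Q : State → Prop} (h : Safe μ Q)
    (y : ENNReal) (g : State → ENNReal) :
    expect μ (fun s => y * g s) = y * expect μ g := by
  unfold expect
  rw [← ENNReal.tsum_mul_left]
  refine tsum_congr fun o => ?_
  by_cases ho : o ∈ μ.support
  · obtain ⟨s, rfl, -⟩ := h o ho
    simp only [Option.elim_some]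
    ring
  · simp [(PMF.apply_eq_zero_iff μ o).2 ho]

/-- The tested register is the variant: it drops in every round, so at most `s.reg x + 1` tests are
made. The last test, which leaves the loop, is the extra `pay 1`. -/
theorem safe_runLoop {x : ℕ} {body : State → PMF (Option State)} (Inv : State → Prop)
    (hstep : ∀ s, Inv s → s.reg x ≠ 0 →
      Safe (body (s.pay 1)) fun s' => Inv s' ∧ s'.reg x < s.reg x) :
    ∀ (fuel : ℕ) (s : State), Inv s → s.reg x < fuel →
      Safe (runLoop x body fuel s) fun s' => ∃ t, s' = t.pay 1 ∧ Inv t ∧ t.reg x = 0 := by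
  intro fuel
  induction fuel with
  | zero => intro s _ h; exact absurd h (Nat.not_lt_zero _)
  | succ k ih =>
    intro s hs hk
    rw [runLoop]
    split_ifs with h
    · exact safe_pure.2 ⟨s, rfl, hs, h⟩
    · exact (hstep s hs h).andThen fun s' hs' => ih s' hs'.1 (by omega)

/-- Optional stopping: `y` is a potential whose expectation does not grow in a round and which
dominates `g` on exit. -/
theorem expect_runLoop_le {x : ℕ} {body : State → PMF (Option State)} {g : State → ENNReal}
    (Inv : State → Prop) (y : State → ENNReal)
    (hstep : ∀ s, Inv s → s.reg x ≠ 0 →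
      Safe (body (s.pay 1)) fun s' => Inv s' ∧ s'.reg x < s.reg x)
    (hzero : ∀ s, Inv s → s.reg x = 0 → g (s.pay 1) ≤ y s)
    (hexp : ∀ s, Inv s → s.reg x ≠ 0 → expect (body (s.pay 1)) y ≤ y s) :
    ∀ (fuel : ℕ) (s : State), Inv s → s.reg x < fuel →
      expect (runLoop x body fuel s) g ≤ y s := by
  intro fuel
  induction fuel with
  | zero => intro s _ h; exact absurd h (Nat.not_lt_zero _)
  | succ k ih =>
    intro s hs hk
    rw [runLoop]
    split_ifs with h
    · rw [expect_pure]; exact hzero s hs h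
    · rw [expect_andThen]
      exact ((hstep s hs h).expect_mono fun s' hs' => ih s' hs'.1 (by omega)).trans (hexp s hs h)

/-- A bound on the expected value of the indicator of failure is a bound on the probability of
success. -/
theorem Safe.le_toOuterMeasure {μ : PMF (Option State)} {Q E : State → Prop} (h : Safe μ Q)
    {y : ENNReal} (g : State → ENNReal) (hg : ∀ s, Q s → ¬ E s → 1 ≤ g s)
    (hy : expect μ g ≤ y) :
    1 - y ≤ μ.toOuterMeasure {o | ∃ s, o = some s ∧ E s} := by
  rw [tsub_le_iff_right]
  refine le_trans ?_ (add_le_add le_rfl hy)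
  rw [PMF.toOuterMeasure_apply, expect, ← ENNReal.tsum_add, ← μ.tsum_coe]
  refine ENNReal.tsum_le_tsum fun o => ?_
  by_cases ho : o ∈ μ.support
  · obtain ⟨s, rfl, hs⟩ := h o ho
    by_cases hE : E s
    · rw [Set.indicator_of_mem (by exact ⟨s, rfl, hE⟩)]
      exact le_self_add
    · exact le_add_left (le_mul_of_one_le_right' (hg s hs hE))
  · simp [(PMF.apply_eq_zero_iff μ o).2 ho]

/-! ### Biased coins and random subsets. -/

/-- `reg 9 :=` a random bit that is `1` with probability `w / 2 ^ b`. -/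
def coin {L : Finset (ℝ × ℝ)} : ℕ → ℕ → Prog L
  | w, 0 => .const 9 w
  | w, b + 1 => .seq (.flip 9) (.ite 9 (coin (w / 2) b) (coin (w - w / 2) b))

/-- The state after `coin w b` has produced `v`. -/
def coinState (s : State) (b v : ℕ) : State :=
  { s with reg := Function.update s.reg 9 v, cost := s.cost + (2 * b + 1) }

theorem coinState_step (s : State) (b u v : ℕ) :
    coinState (((s.setReg 9 u).pay 1).pay 1) b v = coinState s (b + 1) v := by
  simp only [coinState, State.setReg, State.pay, Function.update_idem, State.mk.injEq, true_and]
  push_cast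
  ring

theorem safe_coin {L : Finset (ℝ × ℝ)} {n : ℕ} (O : L → Oracle n) (fuel : ℕ) :
    ∀ (b w : ℕ), w ≤ 2 ^ b → ∀ s : State, Safe ((coin w b).run O fuel s)
      fun s' => s' = coinState s b 0 ∨ s' = coinState s b 1 := by
  intro b
  induction b with
  | zero =>
    intro w hw s
    simp only [coin, Prog.run, safe_pure]
    have : w = 0 ∨ w = 1 := by simp at hw; omega
    rcases this with rfl | rfl <;> simp [coinState, State.setReg, State.pay]
  | succ b ih =>
    intro w hw s
    rw [pow_succ] at hw
    simp only [coin, Prog.run]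
    refine Safe.andThen (Q := fun t => ∃ v, t = (s.setReg 9 v).pay 1) ?_ ?_
    · exact safe_bind fun x => safe_pure.2 ⟨_, rfl⟩
    · rintro _ ⟨v, rfl⟩
      have h1 := ih (w / 2) (by omega) (((s.setReg 9 v).pay 1).pay 1)
      have h2 := ih (w - w / 2) (by omega) (((s.setReg 9 v).pay 1).pay 1)
      simp only [coinState_step] at h1 h2
      split_ifs
      · exact h1
      · exact h2

/-- The numerators `w / 2` and `w - w / 2` of the two branches are at most `2 ^ b` and add up to `w`
also for odd `w`, so averaging the branches gives `w / 2 ^ (b + 1)`. -/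
theorem expect_coin {L : Finset (ℝ × ℝ)} {n : ℕ} (O : L → Oracle n) (fuel : ℕ)
    (g : State → ENNReal) : ∀ (b w : ℕ), w ≤ 2 ^ b → ∀ s : State,
      expect ((coin w b).run O fuel s) g =
        ((w : ENNReal) / 2 ^ b) * g (coinState s b 1) +
          (((2 ^ b - w : ℕ) : ENNReal) / 2 ^ b) * g (coinState s b 0) := by
  intro b
  induction b with
  | zero =>
    intro w hw s
    simp only [coin, Prog.run, expect_pure]
    have : w = 0 ∨ w = 1 := by simp at hw; omega
    rcases this with rfl | rfl <;> simp [coinState, State.setReg, State.pay]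
  | succ b ih =>
    intro w hw s
    rw [pow_succ] at hw
    simp only [coin, Prog.run, expect_andThen, expect_bind, tsum_fintype, Fintype.sum_bool,
      PMF.uniformOfFintype_apply, expect_pure]
    have e1 : ((s.setReg 9 1).pay 1).reg 9 ≠ 0 := by simp [State.setReg, State.pay]
    have e0 : ¬ ((s.setReg 9 0).pay 1).reg 9 ≠ 0 := by simp [State.setReg, State.pay]
    simp only [if_true, Bool.false_eq_true, if_false]
    rw [if_pos e1, if_neg e0, ih _ (by omega), ih _ (by omega)]
    simp only [coinState_step]
    have k1 : (w : ENNReal) = ((w / 2 : ℕ) : ENNReal) + ((w - w / 2 : ℕ) : ENNReal) := by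
      rw [← Nat.cast_add]; congr 1; omega
    have k0 : ((2 ^ (b + 1) - w : ℕ) : ENNReal) =
        ((2 ^ b - w / 2 : ℕ) : ENNReal) + ((2 ^ b - (w - w / 2) : ℕ) : ENNReal) := by
      rw [← Nat.cast_add]; congr 1; rw [pow_succ]; omega
    have k2 : ((2 : ENNReal) ^ (b + 1))⁻¹ = 2⁻¹ * (2 ^ b)⁻¹ := by
      rw [pow_succ, mul_comm, ENNReal.mul_inv] <;> simp
    rw [k0]
    rw [k1]
    simp only [ENNReal.div_eq_inv_mul, k2, Fintype.card_bool, Nat.cast_ofNat]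
    ring

/-- `array 1 :=` a random set that contains every element with probability `w / 2 ^ b`. -/
def sample {L : Finset (ℝ × ℝ)} (w b : ℕ) : Prog L :=
  .seq (.copy 8 0) (.loop 8 (.seq (.sub 8 8 1) (.seq (coin w b) (.store 1 8 9))))

/-- The elements of index below `r`. -/
def below (n r : ℕ) : Finset (Fin n) := Finset.univ.filter fun i => (i : ℕ) < r

/-- The expected value of `h` on the union of `A` with a random subset of the first `r`
elements. -/
def sampleMean {n : ℕ} (p p' : ENNReal) (h : Finset (Fin n) → ENNReal) (r : ℕ)
    (A : Finset (Fin n)) : ENNReal :=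
  ∑ X ∈ (below n r).powerset, p ^ X.card * p' ^ (r - X.card) * h (X ∪ A)

theorem card_below_le (n r : ℕ) : (below n r).card ≤ r := by
  have : (below n r).card ≤ (Finset.range r).card :=
    Finset.card_le_card_of_injOn (fun i => (i : ℕ)) (by intro i; simp [below])
      (fun i _ j _ h => Fin.ext h)
  simpa using this

theorem below_succ {n r : ℕ} (hr : r < n) : below n (r + 1) = insert ⟨r, hr⟩ (below n r) := by
  ext i
  simp only [below, Finset.mem_filter, Finset.mem_univ, true_and, Finset.mem_insert, Fin.ext_iff]
  omega

/-- Condition on whether the element of index `r` is chosen. The truncated exponent `r - X.card` is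
harmless because `X` has at most `r` elements. -/
theorem sampleMean_succ {n r : ℕ} (hr : r < n) (p p' : ENNReal) (h : Finset (Fin n) → ENNReal)
    (A : Finset (Fin n)) :
    sampleMean p p' h (r + 1) A =
      p * sampleMean p p' h r (insert ⟨r, hr⟩ A) + p' * sampleMean p p' h r A := by
  have hnot : (⟨r, hr⟩ : Fin n) ∉ below n r := by simp [below]
  rw [sampleMean, below_succ hr, Finset.sum_powerset_insert hnot, add_comm, sampleMean, sampleMean,
    Finset.mul_sum, Finset.mul_sum]
  congr 1
  · refine Finset.sum_congr rfl fun X hX => ?_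
    have hX' := Finset.mem_powerset.1 hX
    rw [Finset.card_insert_of_notMem fun hx => hnot (hX' hx), Finset.insert_union,
      Finset.union_insert, Nat.add_sub_add_right]
    ring
  · refine Finset.sum_congr rfl fun X hX => ?_
    have := (Finset.card_le_card (Finset.mem_powerset.1 hX)).trans (card_below_le n r)
    rw [Nat.succ_sub this, pow_succ]
    ring

/-- Only scratch registers and the array `a` have been changed. -/
def Frame (a : ℕ) (s s' : State) : Prop :=
  (∀ x < 8, s'.reg x = s.reg x) ∧ ∀ a' ≠ a, s'.arr a' = s.arr a'

theorem Frame.trans {a : ℕ} {s t u : State} (h : Frame a s t) (h' : Frame a t u) :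
    Frame a s u :=
  ⟨fun x hx => (h'.1 x hx).trans (h.1 x hx), fun x hx => (h'.2 x hx).trans (h.2 x hx)⟩

theorem Frame.getSet_eq {a a' : ℕ} {s t : State} (h : Frame a s t) (ha : a' ≠ a) (n : ℕ) :
    t.getSet n a' = s.getSet n a' := by
  simp [State.getSet, h.2 a' ha]

/-- The state after one round of the loop of `sample`. -/
def sampleStep (s : State) (b v : ℕ) : State :=
  { reg := Function.update (Function.update s.reg 8 (s.reg 8 - s.reg 1)) 9 v
    arr := Function.update s.arr 1 (Function.update (s.arr 1) (s.reg 8 - s.reg 1) v)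
    cost := s.cost + (2 * b + 4) }

theorem store_coinState (s : State) (b v : ℕ) :
    ((coinState (((s.pay 1).setReg 8 ((s.pay 1).reg 8 - (s.pay 1).reg 1)).pay 1) b v).setArr 1
      (Function.update ((coinState (((s.pay 1).setReg 8
        ((s.pay 1).reg 8 - (s.pay 1).reg 1)).pay 1) b v).arr 1)
        ((coinState (((s.pay 1).setReg 8 ((s.pay 1).reg 8 - (s.pay 1).reg 1)).pay 1) b v).reg 8)
        ((coinState (((s.pay 1).setReg 8
          ((s.pay 1).reg 8 - (s.pay 1).reg 1)).pay 1) b v).reg 9))).pay 1 = sampleStep s b v := by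
  simp [coinState, State.setReg, State.setArr, State.pay, sampleStep]
  ring

theorem safe_sample_step {L : Finset (ℝ × ℝ)} {n : ℕ} (O : L → Oracle n) (fuel : ℕ) {w b : ℕ}
    (hw : w ≤ 2 ^ b) (s : State) :
    Safe (((.seq (.sub 8 8 1) (.seq (coin w b) (.store 1 8 9)) : Prog L)).run O fuel (s.pay 1))
      fun s' => s' = sampleStep s b 0 ∨ s' = sampleStep s b 1 := by
  simp only [Prog.run, andThen_pure_some]
  refine (safe_coin O fuel b w hw _).andThen ?_
  rintro _ (rfl | rfl)
  · exact safe_pure.2 (Or.inl (store_coinState s b 0))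
  · exact safe_pure.2 (Or.inr (store_coinState s b 1))

theorem expect_sample_step {L : Finset (ℝ × ℝ)} {n : ℕ} (O : L → Oracle n) (fuel : ℕ) {w b : ℕ}
    (hw : w ≤ 2 ^ b) (g : State → ENNReal) (s : State) :
    expect (((.seq (.sub 8 8 1) (.seq (coin w b) (.store 1 8 9)) : Prog L)).run O fuel (s.pay 1)) g
      = ((w : ENNReal) / 2 ^ b) * g (sampleStep s b 1) +
          (((2 ^ b - w : ℕ) : ENNReal) / 2 ^ b) * g (sampleStep s b 0) := by
  simp only [Prog.run, andThen_pure_some]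
  rw [expect_andThen]
  simp only [expect_pure]
  rw [expect_coin O fuel _ b w hw, store_coinState, store_coinState]

/-- The invariant of the loop of `sample`. -/
def SampleInv (n b : ℕ) (s₀ s : State) : Prop :=
  Frame 1 s₀ s ∧ s.reg 0 = n ∧ s.reg 1 = 1 ∧ s.reg 8 ≤ n ∧
    s.cost + s.reg 8 * (2 * b + 4) ≤ s₀.cost + 1 + n * (2 * b + 4)

theorem SampleInv.step {n b : ℕ} {s₀ s : State} (h : SampleInv n b s₀ s) (h8 : s.reg 8 ≠ 0)
    (v : ℕ) : SampleInv n b s₀ (sampleStep s b v) ∧ (sampleStep s b v).reg 8 < s.reg 8 := by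
  obtain ⟨hF, h0, h1, hn, hc⟩ := h
  obtain ⟨r, hr⟩ := Nat.exists_eq_succ_of_ne_zero h8
  refine ⟨⟨hF.trans ⟨fun x hx => ?_, fun a ha => ?_⟩, ?_, ?_, ?_, ?_⟩, ?_⟩
  · simp [sampleStep, (show x ≠ 9 by omega), (show x ≠ 8 by omega)]
  · simp [sampleStep, ha]
  · simpa [sampleStep] using h0
  · simpa [sampleStep] using h1
  · simp [sampleStep]; omega
  · rw [hr] at hc
    simp only [sampleStep, ne_eq, Nat.reduceEqDiff, not_false_eq_true, Function.update_of_ne,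
      Function.update_self, h1, hr, Nat.succ_eq_add_one, Nat.add_sub_cancel] at hc ⊢
    push_cast at hc
    linarith
  · simp [sampleStep]; omega

theorem SampleInv.init {n b : ℕ} {s : State} (h0 : s.reg 0 = n) (h1 : s.reg 1 = 1) :
    SampleInv n b s ((s.setReg 8 (s.reg 0)).pay 1) := by
  refine ⟨⟨fun x hx => ?_, fun a ha => rfl⟩, ?_, ?_, ?_, ?_⟩
  · simp [State.setReg, State.pay, (show x ≠ 8 by omega)]
  · simpa [State.setReg, State.pay] using h0
  · simpa [State.setReg, State.pay] using h1
  · simp [State.setReg, State.pay, h0]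
  · simp [State.setReg, State.pay, h0]

theorem safe_sample {L : Finset (ℝ × ℝ)} {n : ℕ} (O : L → Oracle n) {fuel : ℕ} (hf : n < fuel)
    {w b : ℕ} (hw : w ≤ 2 ^ b) {s : State} (h0 : s.reg 0 = n) (h1 : s.reg 1 = 1) :
    Safe ((sample w b).run O fuel s) fun s' =>
      Frame 1 s s' ∧ s'.cost ≤ s.cost + (n + 1) * (2 * b + 4) := by
  rw [sample, Prog.run, Prog.run, andThen_pure_some, Prog.run]
  refine (safe_runLoop (SampleInv n b s) (fun t ht h8 => ?_) fuel _ (SampleInv.init h0 h1) ?_).mono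
    ?_
  · refine (safe_sample_step O fuel hw t).mono ?_
    rintro _ (rfl | rfl)
    · exact ht.step h8 0
    · exact ht.step h8 1
  · simpa [State.setReg, State.pay, h0] using hf
  · rintro _ ⟨t, rfl, ⟨hF, -, -, -, hc⟩, h8⟩
    refine ⟨hF, ?_⟩
    simp only [State.pay, h8] at hc ⊢
    push_cast at hc
    have : (0 : ℝ) ≤ b := Nat.cast_nonneg b
    linarith

theorem expect_sample_le {L : Finset (ℝ × ℝ)} {n : ℕ} (O : L → Oracle n) {fuel : ℕ}
    (hf : n < fuel) {w b : ℕ} (hw : w ≤ 2 ^ b) {s : State} (h0 : s.reg 0 = n) (h1 : s.reg 1 = 1)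
    (g : State → ENNReal) (h : Finset (Fin n) → ENNReal)
    (hg : ∀ t, Frame 1 s t → g t ≤ h (t.getSet n 1)) :
    expect ((sample w b).run O fuel s) g ≤
      sampleMean ((w : ENNReal) / 2 ^ b) (((2 ^ b - w : ℕ) : ENNReal) / 2 ^ b) h n ∅ := by
  rw [sample, Prog.run, Prog.run, andThen_pure_some, Prog.run]
  -- The potential is the conditional mean given the cells already drawn. Cells below `reg 8` may
  -- hold bits of an earlier sample, hence the difference with `below`.
  refine (expect_runLoop_le (SampleInv n b s) (fun t => sampleMean ((w : ENNReal) / 2 ^ b)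
    (((2 ^ b - w : ℕ) : ENNReal) / 2 ^ b) h (t.reg 8) (t.getSet n 1 \ below n (t.reg 8)))
    (fun t ht h8 => ?_) (fun t ht h8 => ?_) (fun t ht h8 => ?_) fuel _
    (SampleInv.init h0 h1) ?_).trans ?_
  · refine (safe_sample_step O fuel hw t).mono ?_
    rintro _ (rfl | rfl)
    · exact ht.step h8 0
    · exact ht.step h8 1
  · refine (hg (t.pay 1) ht.1).trans (le_of_eq ?_)
    have e : below n 0 = ∅ := by ext i; simp [below]
    simp only [sampleMean, h8, e, Finset.sdiff_empty]
    simp only [Finset.powerset_empty, Finset.sum_singleton, Finset.card_empty, Nat.sub_self,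
      pow_zero, one_mul, Finset.empty_union]
    rfl
  · rw [expect_sample_step O fuel hw]
    obtain ⟨r, hr⟩ := Nat.exists_eq_succ_of_ne_zero h8
    have hrn : r < n := by have := ht.2.2.2.1; omega
    have h1 := ht.2.2.1
    have hreg : ∀ v, (sampleStep t b v).reg 8 = r := by
      intro v; simp [sampleStep, h1, hr]
    have hset1 : (sampleStep t b 1).getSet n 1 \ below n r =
        insert ⟨r, hrn⟩ (t.getSet n 1 \ below n (r + 1)) := by
      ext i
      simp only [sampleStep, State.getSet, h1, hr, below, Function.update_self,
        Function.update_apply, Finset.mem_sdiff, Finset.mem_filter, Finset.mem_univ, true_and,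
        Finset.mem_insert, Fin.ext_iff, Nat.succ_eq_add_one, Nat.add_sub_cancel]
      split_ifs with hi
      · simp [hi]
      · simp only [hi, false_or]
        exact and_congr_right fun _ => by omega
    have hset0 : (sampleStep t b 0).getSet n 1 \ below n r = t.getSet n 1 \ below n (r + 1) := by
      ext i
      simp only [sampleStep, State.getSet, h1, hr, below, Function.update_self,
        Function.update_apply, Finset.mem_sdiff, Finset.mem_filter, Finset.mem_univ, true_and,
        Nat.succ_eq_add_one, Nat.add_sub_cancel]
      split_ifs with hi
      · simp [hi]
      · exact and_congr_right fun _ => by omega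
    simp only [hreg, hset0, hset1]
    rw [hr, Nat.succ_eq_add_one, sampleMean_succ hrn]
  · simpa [State.setReg, State.pay, h0] using hf
  · refine le_of_eq ?_
    have : ((s.setReg 8 (s.reg 0)).pay 1).getSet n 1 \
        below n (((s.setReg 8 (s.reg 0)).pay 1).reg 8) = ∅ := by
      ext i; simp [below, State.pay, State.setReg, h0]
    rw [this]
    simp [State.pay, State.setReg, h0]

/-! ### Unions, cardinalities, and the record of the best solution. -/

theorem sdiff_below {n r : ℕ} (hr : r < n) (C : Finset (Fin n)) :
    C \ below n r = if ⟨r, hr⟩ ∈ C then insert ⟨r, hr⟩ (C \ below n (r + 1))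
      else C \ below n (r + 1) := by
  ext i
  split_ifs with h <;>
    simp only [below, Finset.mem_sdiff, Finset.mem_filter, Finset.mem_univ, true_and,
      Finset.mem_insert]
  · constructor
    · rintro ⟨hi, h'⟩
      rcases eq_or_ne i ⟨r, hr⟩ with e | e
      · exact Or.inl e
      · have : (i : ℕ) ≠ r := fun h => e (Fin.ext h)
        exact Or.inr ⟨hi, by omega⟩
    · rintro (rfl | ⟨hi, h'⟩)
      · exact ⟨h, by simp⟩
      · exact ⟨hi, by omega⟩
  · refine and_congr_right fun hi => ?_
    have : (i : ℕ) ≠ r := fun e => h (by convert hi; exact e.symm)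
    omega

theorem card_sdiff_below {n r : ℕ} (hr : r < n) (C : Finset (Fin n)) :
    (C \ below n r).card = (C \ below n (r + 1)).card + if ⟨r, hr⟩ ∈ C then 1 else 0 := by
  rw [sdiff_below hr]
  split_ifs with h
  · rw [Finset.card_insert_of_notMem]
    simp [below]
  · rfl

/-- Add the arrays `1` and `2` into the array `2` and count the nonzero cells in `reg 11`. -/
def unionStep {L : Finset (ℝ × ℝ)} : Prog L :=
  .seq (.sub 8 8 1) (.seq (.load 9 1 8) (.seq (.load 10 2 8) (.seq (.add 9 9 10)
    (.seq (.store 2 8 9) (.ite 9 (.add 11 11 1) .skip)))))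

def unionCount {L : Finset (ℝ × ℝ)} : Prog L :=
  .seq (.const 11 0) (.seq (.copy 8 0) (.loop 8 unionStep))

theorem safe_unionStep {L : Finset (ℝ × ℝ)} {n : ℕ} (O : L → Oracle n) (fuel : ℕ) {s : State}
    (h1 : s.reg 1 = 1) :
    Safe ((unionStep : Prog L).run O fuel (s.pay 1)) fun s' => Frame 2 s s' ∧
      s'.reg 8 = s.reg 8 - 1 ∧
      s'.arr 2 = Function.update (s.arr 2) (s.reg 8 - 1)
        (s.arr 1 (s.reg 8 - 1) + s.arr 2 (s.reg 8 - 1)) ∧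
      s'.reg 11 = s.reg 11 +
        (if s.arr 1 (s.reg 8 - 1) + s.arr 2 (s.reg 8 - 1) ≠ 0 then 1 else 0) ∧
      s'.cost ≤ s.cost + 8 := by
  simp only [unionStep, Prog.run, andThen_pure_some]
  split_ifs with h <;> rw [safe_pure]
  all_goals
    simp only [State.setReg, State.setArr, State.pay, h1, ne_eq, Nat.reduceEqDiff,
      not_false_eq_true, Function.update_of_ne, Function.update_self] at h ⊢
    refine ⟨⟨fun x hx => ?_, fun a ha => ?_⟩, trivial, trivial, ?_, by linarith⟩
    · simp [(show x ≠ 8 by omega), (show x ≠ 9 by omega), (show x ≠ 10 by omega),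
        (show x ≠ 11 by omega)]
    · simp [ha]
    · first | (exfalso; omega) | simp

theorem safe_unionCount {L : Finset (ℝ × ℝ)} {n : ℕ} (O : L → Oracle n) {fuel : ℕ}
    (hf : n < fuel) {s : State} (h0 : s.reg 0 = n) (h1 : s.reg 1 = 1) :
    Safe ((unionCount : Prog L).run O fuel s) fun s' => Frame 2 s s' ∧
      s'.getSet n 2 = s.getSet n 1 ∪ s.getSet n 2 ∧
      s'.reg 11 = (s.getSet n 1 ∪ s.getSet n 2).card ∧
      s'.cost ≤ s.cost + (8 * n + 3) := by
  rw [unionCount, Prog.run, Prog.run, andThen_pure_some, Prog.run, Prog.run, andThen_pure_some,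
    Prog.run]
  set C := s.getSet n 1 ∪ s.getSet n 2 with hC
  have hmem : ∀ i : Fin n, i ∈ C ↔ s.arr 1 i + s.arr 2 i ≠ 0 := by
    intro i; simp [hC, State.getSet]; omega
  -- Indices run downwards: the cells from `reg 8` to `n - 1` hold the sum, and `reg 11` counts the
  -- elements of the union among them.
  refine (safe_runLoop (fun t => Frame 2 s t ∧ t.reg 8 ≤ n ∧
    (∀ i, t.arr 2 i = if t.reg 8 ≤ i ∧ i < n then s.arr 1 i + s.arr 2 i else s.arr 2 i) ∧
    t.reg 11 = (C \ below n (t.reg 8)).card ∧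
    t.cost + t.reg 8 * 8 ≤ s.cost + 2 + 8 * n) ?_ fuel _ ?_ ?_).mono ?_
  · rintro t ⟨hF, h8n, harr, h11, hc⟩ h8
    refine (safe_unionStep O fuel ((hF.1 1 (by omega)).trans h1)).mono ?_
    obtain ⟨r, hr⟩ := Nat.exists_eq_succ_of_ne_zero h8
    have hrn : r < n := by omega
    rw [hr] at harr h11 hc ⊢
    rintro t' ⟨hF', h8', harr', h11', hc'⟩
    rw [Nat.succ_eq_add_one, Nat.add_sub_cancel] at h8' harr' h11'
    have ha1 : t.arr 1 = s.arr 1 := hF.2 1 (by decide)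
    have har : t.arr 2 r = s.arr 2 r := by rw [harr r, if_neg (by omega)]
    refine ⟨⟨hF.trans hF', by omega, fun i => ?_, ?_, ?_⟩, by omega⟩
    · rw [harr', h8', Function.update_apply]
      split_ifs with hi hj hj
      · rw [har, ha1, hi]
      · omega
      · rw [harr i, if_pos (by omega)]
      · rw [harr i, if_neg (by omega)]
    · rw [h11', h11, h8', card_sdiff_below hrn, har, ha1]
      simp only [hmem]
    · rw [h8']
      push_cast at hc
      linarith
  · refine ⟨⟨fun x hx => ?_, fun a ha => rfl⟩, ?_, fun i => ?_, ?_, ?_⟩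
    · simp [State.setReg, State.pay, (show x ≠ 8 by omega), (show x ≠ 11 by omega)]
    · simp [State.setReg, State.pay, h0]
    · rw [if_neg]
      · rfl
      · simp [State.setReg, State.pay, h0]
    · have : C \ below n n = ∅ := by ext i; simp [below]
      simp [State.setReg, State.pay, h0, this]
    · simp [State.setReg, State.pay, h0]
      linarith
  · simpa [State.setReg, State.pay, h0] using hf
  · rintro _ ⟨t, rfl, ⟨hF, -, harr, h11, hc⟩, h8⟩
    rw [h8] at harr h11 hc
    have e : below n 0 = ∅ := by ext i; simp [below]
    refine ⟨hF, ?_, ?_, ?_⟩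
    · ext i
      rw [hmem]
      simp [State.getSet, State.pay, harr]
    · rw [e, Finset.sdiff_empty] at h11
      exact h11
    · simp only [State.pay]
      push_cast at hc
      linarith

/-- Copy the array `2` to the array `0`. -/
def save {L : Finset (ℝ × ℝ)} : Prog L :=
  .seq (.copy 8 0) (.loop 8 (.seq (.sub 8 8 1) (.seq (.load 9 2 8) (.store 0 8 9))))

theorem safe_save {L : Finset (ℝ × ℝ)} {n : ℕ} (O : L → Oracle n) {fuel : ℕ}
    (hf : n < fuel) {s : State} (h0 : s.reg 0 = n) (h1 : s.reg 1 = 1) :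
    Safe ((save : Prog L).run O fuel s) fun s' => Frame 0 s s' ∧
      s'.getSet n 0 = s.getSet n 2 ∧ s'.cost ≤ s.cost + (4 * n + 2) := by
  rw [save, Prog.run, Prog.run, andThen_pure_some, Prog.run]
  refine (safe_runLoop (fun t => Frame 0 s t ∧ t.reg 8 ≤ n ∧
    (∀ i, t.reg 8 ≤ i → i < n → t.arr 0 i = s.arr 2 i) ∧
    t.cost + t.reg 8 * 4 ≤ s.cost + 1 + 4 * n) ?_ fuel _ ?_ ?_).mono ?_
  · rintro t ⟨hF, h8n, harr, hc⟩ h8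
    obtain ⟨r, hr⟩ := Nat.exists_eq_succ_of_ne_zero h8
    have ht1 := (hF.1 1 (by omega)).trans h1
    have ha2 : t.arr 2 = s.arr 2 := hF.2 2 (by decide)
    simp only [Prog.run, andThen_pure_some]
    rw [safe_pure]
    rw [hr] at harr hc
    simp only [State.setReg, State.setArr, State.pay, ht1, ne_eq, Nat.reduceEqDiff, hr, ha2,
      not_false_eq_true, Function.update_of_ne, Function.update_self, Nat.succ_eq_add_one,
      Nat.add_sub_cancel]
    refine ⟨⟨hF.trans ⟨fun x hx => ?_, fun a ha => ?_⟩, by omega, fun i hi hin => ?_, ?_⟩,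
      by omega⟩
    · simp [(show x ≠ 8 by omega), (show x ≠ 9 by omega)]
    · simp [ha]
    · rw [Function.update_apply]
      split_ifs with h
      · rw [h]
      · exact harr i (by omega) hin
    · push_cast at hc
      linarith
  · refine ⟨⟨fun x hx => ?_, fun a ha => rfl⟩, ?_, fun i hi => ?_, ?_⟩
    · simp [State.setReg, State.pay, (show x ≠ 8 by omega)]
    · simp [State.setReg, State.pay, h0]
    · simp [State.setReg, State.pay, h0] at hi ⊢; omega
    · simp [State.setReg, State.pay, h0]
      linarith
  · simpa [State.setReg, State.pay, h0] using hf
  · rintro _ ⟨t, rfl, ⟨hF, -, harr, hc⟩, h8⟩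
    rw [h8] at harr hc
    refine ⟨hF, ?_, ?_⟩
    · ext i
      rw [State.getSet, State.getSet, Finset.mem_filter, Finset.mem_filter]
      simp [State.pay, harr i (Nat.zero_le _) i.2]
    · simp only [State.pay]
      push_cast at hc
      linarith

/-- The array `0` represents a member of the set system, whose size is in `reg 2`. -/
structure BestInv {n : ℕ} (F : Set (Finset (Fin n))) (s : State) : Prop where
  size : s.reg 0 = n
  one : s.reg 1 = 1
  mem : s.getSet n 0 ∈ F
  card : s.reg 2 = (s.getSet n 0).card

/-- Only scratch registers and the data of the best solution, which has not become worse, have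
been changed, at a cost of at most `K`. -/
structure Improves (K : ℝ) (s s' : State) : Prop where
  reg : ∀ x < 8, x ≠ 2 → s'.reg x = s.reg x
  le : s'.reg 2 ≤ s.reg 2
  cost : s'.cost ≤ s.cost + K

/-- Replace the best solution by the union of the arrays `1` and `2` if that is smaller. -/
def finish {L : Finset (ℝ × ℝ)} : Prog L :=
  .seq unionCount (.seq (.sub 9 2 11) (.ite 9 (.seq (.copy 2 11) save) .skip))

theorem safe_finish {L : Finset (ℝ × ℝ)} {n : ℕ} (O : L → Oracle n) {fuel : ℕ}
    (hf : n < fuel) {F : Set (Finset (Fin n))} {s : State} (h : BestInv F s)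
    (hF : s.getSet n 1 ∪ s.getSet n 2 ∈ F) :
    Safe ((finish : Prog L).run O fuel s) fun s' => BestInv F s' ∧
      Improves (12 * (n + 1)) s s' ∧ s'.reg 2 ≤ (s.getSet n 1 ∪ s.getSet n 2).card := by
  rw [finish, Prog.run]
  refine (safe_unionCount O hf h.size h.one).andThen ?_
  rintro t ⟨hFr, hset, h11, hc⟩
  rw [Prog.run, Prog.run, andThen_pure_some, Prog.run]
  have hset0 : t.getSet n 0 = s.getSet n 0 := hFr.getSet_eq (by decide) n
  have ht2 := hFr.1 2 (by omega)
  split_ifs with h9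
  · rw [Prog.run, Prog.run, andThen_pure_some]
    have hn : (0 : ℝ) ≤ n := Nat.cast_nonneg n
    simp only [State.setReg, State.pay, Function.update_self, ne_eq, Nat.reduceEqDiff,
      not_false_eq_true, Function.update_of_ne] at h9 ⊢
    refine (safe_save O hf ?_ ?_).mono ?_
    · simpa using (hFr.1 0 (by omega)).trans h.size
    · simpa using (hFr.1 1 (by omega)).trans h.one
    · rintro u ⟨hFr', hset', hc'⟩
      have hu2 : u.reg 2 = t.reg 11 := by simpa using hFr'.1 2 (by omega)
      have hureg : ∀ x < 8, x ≠ 2 → u.reg x = s.reg x := by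
        intro x hx hx2
        rw [hFr'.1 x hx, ← hFr.1 x hx]
        simp [hx2, (show x ≠ 9 by omega)]
      have hu0 : u.getSet n 0 = t.getSet n 2 := hset'
      refine ⟨⟨(hureg 0 (by omega) (by omega)).trans h.size,
        (hureg 1 (by omega) (by omega)).trans h.one, ?_, ?_⟩, ⟨hureg, by omega, ?_⟩, by omega⟩
      · rw [hu0, hset]; exact hF
      · rw [hu2, hu0, hset, h11]
      · simp only at hc'
        linarith
  · rw [Prog.run, safe_pure]
    simp only [State.setReg, State.pay, Function.update_self, ne_eq, not_not] at h9 ⊢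
    have hureg : ∀ x < 8, Function.update t.reg 9 (t.reg 2 - t.reg 11) x = s.reg x := by
      intro x hx
      rw [Function.update_of_ne (by omega), hFr.1 x hx]
    have hn : (0 : ℝ) ≤ n := Nat.cast_nonneg n
    refine ⟨⟨(hureg 0 (by omega)).trans h.size, (hureg 1 (by omega)).trans h.one, ?_, ?_⟩,
      ⟨fun x hx _ => hureg x hx, (hureg 2 (by omega)).le, ?_⟩, ?_⟩
    · have := h.mem
      rw [← hset0] at this
      exact this
    · refine (hureg 2 (by omega)).trans (h.card.trans ?_)
      rw [← hset0]; rfl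
    · simp only
      linarith
    · have := hureg 2 (by omega)
      omega

/-! ### A single trial: sample, query, compare. -/

theorem getSet_putSet {n : ℕ} (s : State) (a : ℕ) (Y : Finset (Fin n)) :
    (s.putSet a Y).getSet n a = Y := by
  ext i
  simp only [State.getSet, State.putSet, State.setArr, Function.update_self, Finset.mem_filter,
    Finset.mem_univ, true_and, Finset.mem_image, ne_eq, ite_eq_right_iff, one_ne_zero, imp_false,
    not_not]
  constructor
  · rintro ⟨j, hj, h⟩
    rwa [← Fin.ext h]
  · exact fun h => ⟨i, h, rfl⟩

theorem getSet_putSet_of_ne {n : ℕ} (s : State) {a a' : ℕ} (h : a' ≠ a) (Y : Finset (Fin n)) :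
    (s.putSet a Y).getSet n a' = s.getSet n a' := by
  simp [State.getSet, State.putSet, State.setArr, h]

theorem BestInv.frame {n : ℕ} {F : Set (Finset (Fin n))} {s t : State} (h : BestInv F s)
    (hreg : ∀ x < 3, t.reg x = s.reg x) (harr : t.getSet n 0 = s.getSet n 0) : BestInv F t :=
  ⟨(hreg 0 (by omega)).trans h.size, (hreg 1 (by omega)).trans h.one, harr ▸ h.mem,
    (hreg 2 (by omega)).trans (harr ▸ h.card)⟩

/-- Indicator of the states in which the best solution has more than `B` elements. -/
def bad (B : ℝ) (s : State) : ENNReal := open Classical in if (s.reg 2 : ℝ) ≤ B then 0 else 1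

theorem bad_le_one (B : ℝ) (s : State) : bad B s ≤ 1 := by
  unfold bad; split_ifs <;> simp

theorem bad_of_le {B : ℝ} {s : State} (h : (s.reg 2 : ℝ) ≤ B) : bad B s = 0 := if_pos h

theorem bad_of_not_le {B : ℝ} {s : State} (h : ¬ (s.reg 2 : ℝ) ≤ B) : bad B s = 1 := if_neg h

/-- Sample a set, extend it, and keep the result if it is the smallest one so far. -/
def trial {L : Finset (ℝ × ℝ)} (p : L) (w b : ℕ) : Prog L :=
  .seq (sample w b) (.seq (.query p 1 3 2) finish)

/-- The cost of one trial in which the oracle is called for extensions of size `l`. -/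
def trialCost (c : ℝ) (n b l : ℕ) : ℝ := (n + 1) * (2 * b + 16) + c ^ l

/-- The state after the oracle has answered `Y`. -/
def queryState {n : ℕ} (s : State) (Y : Finset (Fin n)) (q : ℝ) : State := (s.putSet 2 Y).pay q

theorem BestInv.queryState {n : ℕ} {F : Set (Finset (Fin n))} {s t : State} (h : BestInv F s)
    (ht : Frame 1 s t) (Y : Finset (Fin n)) (q : ℝ) : BestInv F (queryState t Y q) := by
  refine h.frame (fun x hx => ht.1 x (by omega)) ?_
  exact (getSet_putSet_of_ne t (show (0 : ℕ) ≠ 2 by decide) Y).trans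
    (ht.getSet_eq (show (0 : ℕ) ≠ 1 by decide) n)

theorem union_queryState {n : ℕ} (t : State) (Y : Finset (Fin n)) (q : ℝ) :
    (queryState t Y q).getSet n 1 ∪ (queryState t Y q).getSet n 2 = t.getSet n 1 ∪ Y :=
  congrArg₂ _ (getSet_putSet_of_ne t (show (1 : ℕ) ≠ 2 by decide) Y) (getSet_putSet t 2 Y)

theorem safe_trial {L : Finset (ℝ × ℝ)} {n : ℕ} {O : L → Oracle n} {fuel : ℕ} (hf : n < fuel)
    {F : Set (Finset (Fin n))} (p : L) (hO : IsExtensionOracle F p.1.1 (O p)) {w b : ℕ}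
    (hw : w ≤ 2 ^ b) {s : State} (h : BestInv F s) :
    Safe ((trial p w b).run O fuel s) fun s' =>
      BestInv F s' ∧ Improves (trialCost p.1.2 n b (s.reg 3)) s s' := by
  rw [trial, Prog.run]
  refine (safe_sample O hf hw h.size h.one).andThen ?_
  rintro t ⟨hF, hc⟩
  rw [Prog.run, Prog.run]
  refine Safe.andThen (Q := fun u => ∃ r, u = queryState t
    ((O p).answer (t.getSet n 1) (t.reg 3) r) (p.1.2 ^ t.reg 3)) ?_ ?_
  · exact safe_bind fun r => safe_pure.2 ⟨r, rfl⟩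
  · rintro _ ⟨r, rfl⟩
    refine (safe_finish O hf (h.queryState hF _ _) ?_).mono ?_
    · rw [union_queryState, Finset.union_comm]
      exact hO.mem _ _ r
    · rintro u ⟨hu, hI, -⟩
      refine ⟨hu, fun x hx hx2 => (hI.reg x hx hx2).trans (hF.1 x hx),
        hI.le.trans (hF.1 2 (by omega)).le, hI.cost.trans ?_⟩
      have h3 := hF.1 3 (by omega)
      simp only [SubsetMin.queryState, State.pay, State.putSet, State.setArr, h3, trialCost]
      linarith

/-- `G` collects samples for which a correct oracle answer gives a set within the bound; the promise
makes the answer incorrect for at most half of the random strings. On all other samples failure is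
conceded. -/
theorem expect_trial_le {L : Finset (ℝ × ℝ)} {n : ℕ} {O : L → Oracle n} {fuel : ℕ} (hf : n < fuel)
    {F : Set (Finset (Fin n))} (p : L) (hO : IsExtensionOracle F p.1.1 (O p)) {w b : ℕ}
    (hw : w ≤ 2 ^ b) {s : State} (h : BestInv F s) {B : ℝ} (G : Set (Finset (Fin n)))
    [DecidablePred (· ∈ G)]
    (hext : ∀ X ∈ G, ∃ S, IsExtension F (s.reg 3) X S)
    (hcard : ∀ X ∈ G, (X.card : ℝ) + p.1.1 * s.reg 3 ≤ B) :
    expect ((trial p w b).run O fuel s) (bad B) ≤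
      sampleMean ((w : ENNReal) / 2 ^ b) (((2 ^ b - w : ℕ) : ENNReal) / 2 ^ b)
        (fun X => if X ∈ G then 2⁻¹ else 1) n ∅ := by
  rw [trial, Prog.run, expect_andThen]
  refine expect_sample_le O hf hw h.size h.one _ _ fun t ht => ?_
  set X := t.getSet n 1 with hX
  have h3 : t.reg 3 = s.reg 3 := ht.1 3 (by omega)
  rw [Prog.run, Prog.run, expect_andThen, expect_bind]
  simp only [expect_pure]
  have hfin : ∀ r, expect ((finish : Prog L).run O fuel
      (queryState t ((O p).answer X (t.reg 3) r) (p.1.2 ^ t.reg 3))) (bad B) ≤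
      open Classical in
      if ((X ∪ (O p).answer X (t.reg 3) r).card : ℝ) ≤ B then 0 else 1 := by
    intro r
    have hun : (queryState t ((O p).answer X (t.reg 3) r) (p.1.2 ^ t.reg 3)).getSet n 1 ∪
        (queryState t ((O p).answer X (t.reg 3) r) (p.1.2 ^ t.reg 3)).getSet n 2 =
        X ∪ (O p).answer X (t.reg 3) r := union_queryState _ _ _
    refine (safe_finish O hf (h.queryState ht _ _) ?_).expect_le fun u hu => ?_
    · rw [hun, Finset.union_comm]
      exact hO.mem _ _ r
    · rw [hun] at hu
      split_ifs with hB
      · exact (bad_of_le ((Nat.cast_le.2 hu.2.2).trans hB)).le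
      · exact bad_le_one B u
  refine (ENNReal.tsum_le_tsum fun r => mul_le_mul_right (hfin r) _).trans ?_
  rw [tsum_fintype]
  simp only [PMF.uniformOfFintype_apply]
  rw [← Finset.mul_sum]
  set M : ℕ := Fintype.card (Fin (O p).m → Bool) with hM
  have hM0 : M ≠ 0 := Fintype.card_ne_zero
  split_ifs with hG
  · obtain ⟨S, hS⟩ := hext X hG
    have hhalf := hO.half X (s.reg 3) ⟨S, hS⟩
    classical
    rw [Set.ncard_eq_toFinset_card'] at hhalf
    set R := {r : Fin (O p).m → Bool | IsExtension F (p.1.1 * (s.reg 3 : ℝ)) X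
      ((O p).answer X (s.reg 3) r)}.toFinset with hR
    have hle : ∑ r : Fin (O p).m → Bool,
        (if ((X ∪ (O p).answer X (t.reg 3) r).card : ℝ) ≤ B then (0 : ENNReal) else 1) ≤
        (Rᶜ.card : ENNReal) := by
      rw [Finset.card_eq_sum_ones, Nat.cast_sum, ← Finset.sum_filter_add_sum_filter_not
        Finset.univ (· ∈ R)]
      have e1 : ∑ r ∈ Finset.univ.filter (· ∈ R),
          (if ((X ∪ (O p).answer X (t.reg 3) r).card : ℝ) ≤ B then (0 : ENNReal) else 1) = 0 := by
        refine Finset.sum_eq_zero fun r hr => if_pos ?_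
        have hr' : IsExtension F (p.1.1 * (s.reg 3 : ℝ)) X ((O p).answer X (s.reg 3) r) := by
          simpa [hR] using hr
        have hc1 := hcard X hG
        have hc2 := hr'.2
        have hc3 : ((X ∪ (O p).answer X (t.reg 3) r).card : ℝ) ≤
            X.card + ((O p).answer X (t.reg 3) r).card := by
          exact_mod_cast Finset.card_union_le _ _
        rw [h3] at hc3 ⊢
        linarith
      rw [e1, zero_add]
      have e2 : Finset.univ.filter (fun r => ¬ r ∈ R) = Rᶜ := by ext; simp
      rw [e2]
      refine Finset.sum_le_sum fun r _ => ?_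
      split_ifs <;> simp
    refine (mul_le_mul_right hle _).trans ?_
    have hcompl : (2 * Rᶜ.card : ℕ) ≤ M := by
      rw [Finset.card_compl, ← hM]
      have : (M : ℝ) ≤ ((2 * R.card : ℕ) : ℝ) := by push_cast; linarith
      have := Nat.cast_le.1 this
      omega
    have hcompl' : (2 : ENNReal) * Rᶜ.card ≤ M := by exact_mod_cast hcompl
    rw [← ENNReal.div_eq_inv_mul, ENNReal.div_le_iff (by simpa using hM0) (by simp)]
    rw [← ENNReal.div_eq_inv_mul, ENNReal.le_div_iff_mul_le (by simp) (by simp), mul_comm]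
    exact hcompl'
  · refine (mul_le_mul_right (Finset.sum_le_sum (g := fun _ => (1 : ENNReal)) fun r _ => ?_) _).trans
      ?_
    · split_ifs <;> simp
    · rw [Finset.sum_const, nsmul_one, Finset.card_univ]
      exact ENNReal.inv_mul_le_one _

/-! ### Independent repetition of trials. -/

/-- Repeat `trial` as often as `reg 4` says. -/
def trials {L : Finset (ℝ × ℝ)} (p : L) (w b : ℕ) : Prog L :=
  .loop 4 (.seq (.sub 4 4 1) (trial p w b))

/-- The invariant of the loop of `trials`. -/
structure TrialsInv {n : ℕ} (F : Set (Finset (Fin n))) (K : ℝ) (s t : State) : Prop where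
  best : BestInv F t
  reg : ∀ x < 8, x ≠ 2 → x ≠ 4 → t.reg x = s.reg x
  le : t.reg 2 ≤ s.reg 2
  cost : t.cost + t.reg 4 * (K + 2) ≤ s.cost + s.reg 4 * (K + 2)

theorem safe_trials_step {L : Finset (ℝ × ℝ)} {n : ℕ} {O : L → Oracle n} {fuel : ℕ}
    (hf : n < fuel) {F : Set (Finset (Fin n))} (p : L) (hO : IsExtensionOracle F p.1.1 (O p))
    {w b : ℕ} (hw : w ≤ 2 ^ b) {s t : State}
    (ht : TrialsInv F (trialCost p.1.2 n b (s.reg 3)) s t) (h4 : t.reg 4 ≠ 0) :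
    Safe ((.seq (.sub 4 4 1) (trial p w b) : Prog L).run O fuel (t.pay 1)) fun t' =>
      TrialsInv F (trialCost p.1.2 n b (s.reg 3)) s t' ∧ t'.reg 4 = t.reg 4 - 1 ∧
        t'.reg 2 ≤ t.reg 2 := by
  rw [Prog.run, Prog.run, andThen_pure_some]
  have h1 := ht.best.one
  obtain ⟨r, hr⟩ := Nat.exists_eq_succ_of_ne_zero h4
  have hb : BestInv F (((t.pay 1).setReg 4 ((t.pay 1).reg 4 - (t.pay 1).reg 1)).pay 1) := by
    refine ht.best.frame (fun x hx => ?_) rfl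
    simp [State.pay, State.setReg, (show x ≠ 4 by omega)]
  refine (safe_trial hf p hO hw hb).mono ?_
  · rintro u ⟨hu, hI⟩
    have hc := hI.cost
    have h3 := ht.reg 3 (by omega) (by omega) (by omega)
    have h4' := hI.reg 4 (by omega) (by omega)
    have h2' := hI.le
    simp only [State.pay, State.setReg, h1, Function.update_self, ne_eq, Nat.reduceEqDiff,
      not_false_eq_true, Function.update_of_ne, h3] at hc h4' h2'
    refine ⟨⟨hu, fun x hx hx2 hx4 => ?_, h2'.trans ht.le, ?_⟩, h4', h2'⟩
    · rw [hI.reg x hx hx2, ← ht.reg x hx hx2 hx4]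
      simp [State.pay, State.setReg, hx4]
    · have := ht.cost
      rw [h4', hr]
      rw [hr] at this
      push_cast [Nat.succ_eq_add_one, Nat.add_sub_cancel] at this ⊢
      linarith

theorem safe_trials {L : Finset (ℝ × ℝ)} {n : ℕ} {O : L → Oracle n} {fuel : ℕ}
    (hf : n < fuel) {F : Set (Finset (Fin n))} (p : L) (hO : IsExtensionOracle F p.1.1 (O p))
    {w b : ℕ} (hw : w ≤ 2 ^ b) {s : State} (h : BestInv F s) (h4 : s.reg 4 < fuel) :
    Safe ((trials p w b).run O fuel s) fun t => BestInv F t ∧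
      (∀ x < 8, x ≠ 2 → x ≠ 4 → t.reg x = s.reg x) ∧ t.reg 2 ≤ s.reg 2 ∧
      t.cost ≤ s.cost + (s.reg 4 * (trialCost p.1.2 n b (s.reg 3) + 2) + 1) := by
  rw [trials, Prog.run]
  refine (safe_runLoop (TrialsInv F (trialCost p.1.2 n b (s.reg 3)) s) (fun t ht h0 => ?_) fuel s
    ⟨h, fun _ _ _ _ => rfl, le_rfl, le_rfl⟩ h4).mono ?_
  · exact (safe_trials_step hf p hO hw ht h0).mono fun t' ht' => ⟨ht'.1, by omega⟩
  · rintro _ ⟨t, rfl, ht, h0⟩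
    have hc := ht.cost
    rw [h0] at hc
    refine ⟨ht.best.frame (fun _ _ => rfl) rfl, ht.reg, ht.le, ?_⟩
    simp only [State.pay]
    push_cast at hc
    linarith

theorem expect_trials_le {L : Finset (ℝ × ℝ)} {n : ℕ} {O : L → Oracle n} {fuel : ℕ}
    (hf : n < fuel) {F : Set (Finset (Fin n))} (p : L) (hO : IsExtensionOracle F p.1.1 (O p))
    {w b : ℕ} (hw : w ≤ 2 ^ b) {s : State} (h : BestInv F s) (h4 : s.reg 4 < fuel) {B : ℝ}
    {y : ENNReal} (hy : ∀ t, BestInv F t → t.reg 3 = s.reg 3 →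
      expect ((trial p w b).run O fuel t) (bad B) ≤ y) :
    expect ((trials p w b).run O fuel s) (bad B) ≤ y ^ s.reg 4 := by
  rw [trials, Prog.run]
  -- The potential is the failure bound for the remaining rounds times `bad`. Since `reg 2` never
  -- grows, `bad` never returns from 0 to 1, so only rounds that start in a bad state matter.
  refine (expect_runLoop_le (TrialsInv F (trialCost p.1.2 n b (s.reg 3)) s)
    (fun t => y ^ t.reg 4 * bad B t) (fun t ht h0 => ?_) (fun t ht h0 => ?_) (fun t ht h0 => ?_)
    fuel s ⟨h, fun _ _ _ _ => rfl, le_rfl, le_rfl⟩ h4).trans ?_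
  · exact (safe_trials_step hf p hO hw ht h0).mono fun t' ht' => ⟨ht'.1, by omega⟩
  · rw [h0, pow_zero, one_mul]
    exact le_of_eq rfl
  · have hsafe := safe_trials_step hf p hO hw ht h0
    by_cases hB : (t.reg 2 : ℝ) ≤ B
    · refine hsafe.expect_le fun t' ht' => ?_
      rw [bad_of_le ((Nat.cast_le.2 ht'.2.2).trans hB), mul_zero]
      exact zero_le
    · obtain ⟨r, hr⟩ := Nat.exists_eq_succ_of_ne_zero h0
      refine (hsafe.expect_mono (g' := fun t' => y ^ r * bad B t') fun t' ht' => ?_).trans ?_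
      · rw [ht'.2.1, hr]; simp
      · rw [hsafe.expect_const_mul, bad_of_not_le hB, hr, pow_succ, mul_one]
        refine mul_le_mul_right ?_ _
        rw [Prog.run, Prog.run, andThen_pure_some]
        refine hy _ (ht.best.frame (fun x hx => ?_) rfl) ?_
        · simp [State.pay, State.setReg, (show x ≠ 4 by omega)]
        · simpa [State.pay, State.setReg] using ht.reg 3 (by omega) (by omega) (by omega)
  · exact (mul_le_mul_right (bad_le_one B s) _).trans (mul_one _).le

/-! ### Success probability of repeated sampling. -/

/-- The parts of a set inside and outside of `T` can be chosen independently. -/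
theorem card_filter_inter_sdiff {n : ℕ} (T : Finset (Fin n)) (i j : ℕ) :
    T.card.choose i * (n - T.card).choose j ≤
      (Finset.univ.filter fun X : Finset (Fin n) => (X ∩ T).card = i ∧ (X \ T).card = j).card := by
  have hc : (Tᶜ).card = n - T.card := by rw [Finset.card_compl, Fintype.card_fin]
  rw [← hc, ← Finset.card_powersetCard, ← Finset.card_powersetCard, ← Finset.card_product]
  have key : ∀ A B : Finset (Fin n), A ⊆ T → B ⊆ Tᶜ → (A ∪ B) ∩ T = A ∧ (A ∪ B) \ T = B := by
    intro A B hA hB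
    constructor <;> ext x <;>
      have h1 := @hA x <;> have h2 := @hB x <;>
      simp only [Finset.mem_compl, Finset.mem_inter, Finset.mem_union, Finset.mem_sdiff] at * <;>
      tauto
  refine Finset.card_le_card_of_injOn (fun q => q.1 ∪ q.2) ?_ ?_
  · rintro ⟨A, B⟩ h
    simp only [Finset.coe_product, Set.mem_prod, Finset.mem_coe, Finset.mem_powersetCard] at h
    obtain ⟨e1, e2⟩ := key A B h.1.1 h.2.1
    simp only [Finset.coe_filter, Set.mem_ofPred_eq, e1, e2]
    exact ⟨Finset.mem_univ _, h.1.2, h.2.2⟩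
  · rintro ⟨A, B⟩ h ⟨A', B'⟩ h' hAB
    simp only [Finset.coe_product, Set.mem_prod, Finset.mem_coe, Finset.mem_powersetCard] at h h'
    obtain ⟨e1, e2⟩ := key A B h.1.1 h.2.1
    obtain ⟨e1', e2'⟩ := key A' B' h'.1.1 h'.2.1
    simp only at hAB
    exact Prod.ext ((e1.symm.trans (by rw [hAB])).trans e1') ((e2.symm.trans (by rw [hAB])).trans e2')

/-- The sampling weights sum to 1, and every set in `G` saves half of its weight. There are at least
`T.card.choose i * (n - T.card).choose j` of them, all of equal weight. -/
theorem sampleMean_le {n : ℕ} {p p' : ENNReal} (hp : p + p' = 1) (T : Finset (Fin n)) (i j : ℕ)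
    (G : Set (Finset (Fin n))) [DecidablePred (· ∈ G)]
    (hG : ∀ X, X ∈ G ↔ (X ∩ T).card = i ∧ (X \ T).card = j) :
    sampleMean p p' (fun X => if X ∈ G then 2⁻¹ else 1) n ∅ ≤
      1 - 2⁻¹ * (T.card.choose i * (n - T.card).choose j * (p ^ (i + j) * p' ^ (n - (i + j)))) := by
  have hp1 : p ≤ 1 := hp ▸ le_self_add
  have hp1' : p' ≤ 1 := hp ▸ le_add_self
  have hfin : p ^ (i + j) * p' ^ (n - (i + j)) ≠ ⊤ :=
    ((mul_le_mul' (pow_le_one₀ zero_le hp1) (pow_le_one₀ zero_le hp1')).trans_lt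
      (by simp)).ne
  refine ENNReal.le_sub_of_add_le_right ?_ ?_
  · exact ENNReal.mul_ne_top (by simp)
      (ENNReal.mul_ne_top (ENNReal.mul_ne_top (by simp) (by simp)) hfin)
  have hb : below n n = Finset.univ := by ext x; simp [below]
  have hsum : ∑ X : Finset (Fin n), p ^ X.card * p' ^ (n - X.card) = 1 := by
    have := Finset.sum_pow_mul_eq_add_pow p p' (Finset.univ : Finset (Fin n))
    simpa [hp] using this
  have hlow : 2⁻¹ * (T.card.choose i * (n - T.card).choose j * (p ^ (i + j) * p' ^ (n - (i + j)))) ≤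
      ∑ X : Finset (Fin n), p ^ X.card * p' ^ (n - X.card) * if X ∈ G then 2⁻¹ else 0 := by
    have e : ∑ X : Finset (Fin n), p ^ X.card * p' ^ (n - X.card) * (if X ∈ G then 2⁻¹ else 0) =
        ∑ X ∈ Finset.univ.filter (fun X : Finset (Fin n) => (X ∩ T).card = i ∧ (X \ T).card = j),
          p ^ (i + j) * p' ^ (n - (i + j)) * 2⁻¹ := by
      rw [Finset.sum_filter]
      refine Finset.sum_congr rfl fun X _ => ?_
      simp only [hG]
      split_ifs with h
      · rw [← Finset.card_inter_add_card_sdiff X T, h.1, h.2]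
      · simp
    rw [e, Finset.sum_const, nsmul_eq_mul]
    calc _ = ((T.card.choose i * (n - T.card).choose j : ℕ) : ENNReal) *
          (p ^ (i + j) * p' ^ (n - (i + j)) * 2⁻¹) := by push_cast; ring
      _ ≤ _ := mul_le_mul_left (Nat.cast_le.2 (card_filter_inter_sdiff T i j)) _
  refine (add_le_add le_rfl hlow).trans ?_
  rw [sampleMean, hb, Finset.powerset_univ, ← Finset.sum_add_distrib]
  refine le_of_le_of_eq (Finset.sum_le_sum fun X _ => ?_) hsum
  rw [← mul_add, Finset.union_empty]
  refine (mul_le_mul_right (le_of_eq ?_) _).trans (mul_one _).le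
  split_ifs
  · exact ENNReal.inv_two_add_inv_two
  · simp

/-- By `1 - x ≤ exp (-x)` the power is at most `exp (-N * q / 2) ≤ exp (-1)`. -/
theorem pow_le_half {q : ℝ} (hq : 0 ≤ q) {N : ℕ} (h : 2 ≤ N * q) :
    (1 - 2⁻¹ * ENNReal.ofReal q) ^ N ≤ 2⁻¹ := by
  have e : 1 - 2⁻¹ * ENNReal.ofReal q = ENNReal.ofReal (1 - q / 2) := by
    rw [ENNReal.ofReal_sub _ (by positivity), ENNReal.ofReal_one, div_eq_inv_mul,
      ENNReal.ofReal_mul (by norm_num), ENNReal.ofReal_inv_of_pos (by norm_num)]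
    simp
  -- For `q ≥ 2` the subtraction in `ENNReal` truncates to 0, and `N ≠ 0` is what makes the power
  -- vanish.
  rcases le_total (1 - q / 2) 0 with hneg | hpos
  · have hN : N ≠ 0 := by rintro rfl; norm_num at h
    rw [e, ENNReal.ofReal_of_nonpos hneg, zero_pow hN]
    exact zero_le
  · rw [e, ← ENNReal.ofReal_pow hpos, show (2⁻¹ : ENNReal) = ENNReal.ofReal 2⁻¹ by
      rw [ENNReal.ofReal_inv_of_pos (by norm_num)]; simp]
    refine ENNReal.ofReal_le_ofReal ?_
    have h1 : 1 - q / 2 ≤ Real.exp (-(q / 2)) := by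
      have := Real.add_one_le_exp (-(q / 2)); linarith
    calc (1 - q / 2) ^ N ≤ Real.exp (-(q / 2)) ^ N := pow_le_pow_left₀ hpos h1 N
      _ = Real.exp (-(N * q / 2)) := by rw [← Real.exp_nat_mul]; congr 1; ring
      _ ≤ Real.exp (-1) := Real.exp_le_exp.2 (by linarith)
      _ ≤ 2⁻¹ := by
        rw [Real.exp_neg]
        refine inv_anti₀ (by norm_num) ?_
        have := Real.add_one_le_exp (1 : ℝ); linarith

/-! ### Strategies and when they succeed. -/

/-- The parameters of one phase of the algorithm: elements are sampled with probability
`w / 2 ^ b`; with `q = ⌈n / m⌉`, there are `2 ^ (e * q + a)` trials for every extension size up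
to `f * q`. -/
structure Strategy where
  w : ℕ
  b : ℕ
  m : ℕ
  e : ℕ
  f : ℕ
  a : ℕ
  w_le : w ≤ 2 ^ b
  m_pos : 0 < m

namespace Strategy

def blocks (S : Strategy) (n : ℕ) : ℕ := (n + S.m - 1) / S.m

def reps (S : Strategy) (n : ℕ) : ℕ := 2 ^ (S.e * S.blocks n + S.a)

def maxLen (S : Strategy) (n : ℕ) : ℕ := S.f * S.blocks n

/-- The sampling probability. -/
def prob (S : Strategy) : ℝ := S.w / 2 ^ S.b

theorem prob_nonneg (S : Strategy) : 0 ≤ S.prob := by unfold prob; positivity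

theorem prob_le_one (S : Strategy) : S.prob ≤ 1 := by
  unfold prob
  rw [div_le_one (by positivity)]
  exact_mod_cast S.w_le

theorem blocks_eq (S : Strategy) {n q : ℕ} (h1 : n ≤ S.m * q) (h2 : S.m * q < n + S.m) :
    S.blocks n = q := by
  have := S.m_pos
  refine Nat.div_eq_of_lt_le ?_ ?_
  · rw [mul_comm]; omega
  · rw [Nat.add_mul, mul_comm]; omega

theorem le_blocks (S : Strategy) (n : ℕ) : n ≤ S.m * S.blocks n := by
  have := S.m_pos
  have h := Nat.div_add_mod (n + S.m - 1) S.m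
  have h' := Nat.mod_lt (n + S.m - 1) this
  unfold blocks
  omega

theorem blocks_lt (S : Strategy) (n : ℕ) : S.m * S.blocks n < n + S.m := by
  have := S.m_pos
  have h := Nat.div_add_mod (n + S.m - 1) S.m
  unfold blocks
  omega

/-- The strategy finds, with probability at least one half, a solution with at most `β * k`
elements if the smallest solution has `k` elements. -/
def Works (S : Strategy) (α β : ℝ) (n k : ℕ) : Prop :=
  ∃ l i j : ℕ, l ≤ S.maxLen n ∧ k ≤ i + l ∧ ((i + j : ℕ) : ℝ) + α * l ≤ β * k ∧
    2 ≤ (S.reps n : ℝ) * (k.choose i * (n - k).choose j *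
      (S.prob ^ (i + j) * (1 - S.prob) ^ (n - (i + j))))

end Strategy

/-- The program does not know `T.card`, hence not the right length `l`; what counts is that one `l`
among those it tries works from every admissible state. -/
theorem exists_expect_trials_le {L : Finset (ℝ × ℝ)} {n : ℕ} {O : L → Oracle n} {fuel : ℕ}
    (hf : n < fuel) {F : Set (Finset (Fin n))} (hM : IsMonotoneSystem F) (p : L)
    (hO : IsExtensionOracle F p.1.1 (O p)) (S : Strategy) {β : ℝ} {T : Finset (Fin n)}
    (hT : T ∈ F) (hS : S.Works p.1.1 β n T.card) (hN : S.reps n < fuel) :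
    ∃ l ≤ S.maxLen n, ∀ s, BestInv F s → s.reg 3 = l → s.reg 4 = S.reps n →
      expect ((trials p S.w S.b).run O fuel s) (bad (β * T.card)) ≤ 2⁻¹ := by
  classical
  obtain ⟨l, i, j, hl, hkl, hcard, hprob⟩ := hS
  refine ⟨l, hl, fun s hs h3 h4 => ?_⟩
  set q : ℝ := T.card.choose i * (n - T.card).choose j *
      (S.prob ^ (i + j) * (1 - S.prob) ^ (n - (i + j))) with hq
  have hp0 := S.prob_nonneg
  have hp1 := sub_nonneg.2 S.prob_le_one
  have hq0 : 0 ≤ q := by positivity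
  refine (expect_trials_le hf p hO S.w_le hs (by omega) (y := 1 - 2⁻¹ * ENNReal.ofReal q)
    fun t ht ht3 => ?_).trans ?_
  · have e1 : (S.w : ENNReal) / 2 ^ S.b = ENNReal.ofReal S.prob := by
      rw [Strategy.prob, ENNReal.ofReal_div_of_pos (by positivity), ENNReal.ofReal_natCast,
        ENNReal.ofReal_pow (by norm_num)]
      simp
    have e2 : ((2 ^ S.b - S.w : ℕ) : ENNReal) / 2 ^ S.b = ENNReal.ofReal (1 - S.prob) := by
      have : 1 - S.prob = ((2 ^ S.b - S.w : ℕ) : ℝ) / 2 ^ S.b := by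
        rw [Nat.cast_sub S.w_le, Strategy.prob]
        push_cast
        field_simp
      rw [this, ENNReal.ofReal_div_of_pos (by positivity), ENNReal.ofReal_natCast,
        ENNReal.ofReal_pow (by norm_num)]
      simp
    have e3 : ENNReal.ofReal S.prob + ENNReal.ofReal (1 - S.prob) = 1 := by
      rw [← ENNReal.ofReal_add hp0 hp1]; simp
    have e4 : ENNReal.ofReal q = T.card.choose i * (n - T.card).choose j *
        (ENNReal.ofReal S.prob ^ (i + j) * ENNReal.ofReal (1 - S.prob) ^ (n - (i + j))) := by
      rw [hq, ENNReal.ofReal_mul (by positivity), ENNReal.ofReal_mul (by positivity),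
        ENNReal.ofReal_mul (by positivity), ENNReal.ofReal_natCast, ENNReal.ofReal_natCast,
        ENNReal.ofReal_pow hp0, ENNReal.ofReal_pow hp1]
    rw [e4]
    refine le_trans (expect_trial_le hf p hO S.w_le ht
      {X | (X ∩ T).card = i ∧ (X \ T).card = j} ?_ ?_) ?_
    · rintro X ⟨hi, -⟩
      -- The missing part of `T` extends `X`; it has `T.card - i ≤ l` elements.
      refine ⟨T \ X, hM.superset_mem T _ (fun x hx => ?_) hT, ?_⟩
      · simp only [Finset.mem_union, Finset.mem_sdiff]; tauto
      · have := Finset.card_inter_add_card_sdiff T X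
        rw [Finset.inter_comm, hi] at this
        rw [ht3, h3]
        exact_mod_cast (by omega : (T \ X).card ≤ l)
    · rintro X ⟨hi, hj⟩
      rw [← Finset.card_inter_add_card_sdiff X T, hi, hj, ht3, h3]
      exact hcard
    · rw [e1, e2]
      exact sampleMean_le e3 T i j _ fun X => Iff.rfl
  · rw [h4]
    exact pow_le_half hq0 hprob

/-! ### Programs for one phase and for a list of phases. -/

/-- `reg 3 := f * ⌈n / m⌉` and `reg 6 := e * ⌈n / m⌉ + a`. -/
def exponents {L : Finset (ℝ × ℝ)} (m e f a : ℕ) : Prog L :=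
  .seq (.const 3 0) (.seq (.const 6 a) (.seq (.const 9 m) (.seq (.const 10 e)
    (.seq (.const 11 f) (.seq (.copy 8 0)
      (.loop 8 (.seq (.sub 8 8 9) (.seq (.add 6 6 10) (.add 3 3 11)))))))))

/-- Truncated subtraction of `m` from `n` reaches 0 after exactly `⌈n / m⌉` rounds; `S.m * q < n +
S.m` in the invariant excludes a round too many. -/
theorem safe_exponents {L : Finset (ℝ × ℝ)} {n : ℕ} (O : L → Oracle n) {fuel : ℕ} (hf : n < fuel)
    {F : Set (Finset (Fin n))} (S : Strategy) {s : State} (h : BestInv F s) :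
    Safe ((exponents S.m S.e S.f S.a : Prog L).run O fuel s) fun t => BestInv F t ∧
      t.reg 2 = s.reg 2 ∧ t.reg 3 = S.maxLen n ∧ t.reg 6 = S.e * S.blocks n + S.a ∧
      t.cost ≤ s.cost + (4 * n + 7) := by
  simp only [exponents, Prog.run, andThen_pure_some]
  have hm := S.m_pos
  refine (safe_runLoop (fun t => BestInv F t ∧ t.reg 2 = s.reg 2 ∧ t.reg 9 = S.m ∧
    t.reg 10 = S.e ∧ t.reg 11 = S.f ∧ ∃ q, t.reg 8 = n - S.m * q ∧ S.m * q < n + S.m ∧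
      t.reg 3 = S.f * q ∧ t.reg 6 = S.e * q + S.a ∧
      t.cost + t.reg 8 * 4 ≤ s.cost + 6 + 4 * n) ?_ fuel _ ?_ ?_).mono ?_
  · rintro t ⟨hb, h2, h9, h10, h11, q, h8, hq, h3, h6, hc⟩ h0
    rw [safe_pure]
    simp only [State.setReg, State.pay, ne_eq, Nat.reduceEqDiff, not_false_eq_true,
      Function.update_of_ne, Function.update_self]
    refine ⟨⟨hb.frame (fun x hx => ?_) rfl, by simpa using h2, by simpa using h9,
      by simpa using h10, by simpa using h11, q + 1, ?_, ?_, ?_, ?_, ?_⟩, ?_⟩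
    · simp [(show x ≠ 3 by omega), (show x ≠ 6 by omega), (show x ≠ 8 by omega)]
    · rw [h8, h9, Nat.mul_succ]; omega
    · rw [Nat.mul_succ]; omega
    · rw [h3, h11, Nat.mul_succ]
    · rw [h6, h10, Nat.mul_succ]; omega
    · have h1 : ((t.reg 8 - t.reg 9 : ℕ) : ℝ) + 1 ≤ t.reg 8 := by
        exact_mod_cast (by omega : t.reg 8 - t.reg 9 + 1 ≤ t.reg 8)
      linarith
    · omega
  · refine ⟨h.frame (fun x hx => ?_) rfl, ?_, ?_, ?_, ?_, 0, ?_, ?_, ?_, ?_, ?_⟩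
    · simp [State.setReg, State.pay, (show x ≠ 3 by omega), (show x ≠ 6 by omega),
        (show x ≠ 8 by omega), (show x ≠ 9 by omega), (show x ≠ 10 by omega),
        (show x ≠ 11 by omega)]
    all_goals simp [State.setReg, State.pay, h.size]
    · omega
    · linarith
  · simpa [State.setReg, State.pay, h.size] using hf
  · rintro _ ⟨t, rfl, ⟨hb, h2, -, -, -, q, h8, hq, h3, h6, hc⟩, h0⟩
    have hqb := S.blocks_eq (n := n) (q := q) (by omega) hq
    refine ⟨hb.frame (fun _ _ => rfl) rfl, h2, ?_, ?_, ?_⟩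
    · rw [Strategy.maxLen, hqb]; exact h3
    · rw [hqb]; exact h6
    · rw [h0] at hc
      simp only [State.pay]
      push_cast at hc
      linarith

/-- `reg 5 := 2 ^ reg 6` -/
def power {L : Finset (ℝ × ℝ)} : Prog L :=
  .seq (.const 5 1) (.loop 6 (.seq (.sub 6 6 1) (.add 5 5 5)))

theorem safe_power {L : Finset (ℝ × ℝ)} {n : ℕ} (O : L → Oracle n) {fuel : ℕ}
    {F : Set (Finset (Fin n))} {s : State} (h : BestInv F s) (hf : s.reg 6 < fuel) :
    Safe ((power : Prog L).run O fuel s) fun t => BestInv F t ∧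
      t.reg 2 = s.reg 2 ∧ t.reg 3 = s.reg 3 ∧ t.reg 5 = 2 ^ s.reg 6 ∧
      t.cost ≤ s.cost + (3 * s.reg 6 + 2) := by
  simp only [power, Prog.run, andThen_pure_some]
  refine (safe_runLoop (fun t => BestInv F t ∧ t.reg 2 = s.reg 2 ∧ t.reg 3 = s.reg 3 ∧
    t.reg 6 ≤ s.reg 6 ∧ t.reg 5 * 2 ^ t.reg 6 = 2 ^ s.reg 6 ∧
    t.cost + t.reg 6 * 3 ≤ s.cost + 1 + s.reg 6 * 3) ?_ fuel _ ?_ ?_).mono ?_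
  · rintro t ⟨hb, h2, h3, h6, h5, hc⟩ h0
    obtain ⟨r, hr⟩ := Nat.exists_eq_succ_of_ne_zero h0
    rw [safe_pure]
    simp only [State.setReg, State.pay, ne_eq, Nat.reduceEqDiff, not_false_eq_true,
      Function.update_of_ne, Function.update_self, hb.one]
    rw [hr] at h5 hc h6 ⊢
    refine ⟨⟨hb.frame (fun x hx => ?_) rfl, by simpa using h2, by simpa using h3, ?_, ?_, ?_⟩, ?_⟩
    · simp [(show x ≠ 5 by omega), (show x ≠ 6 by omega)]
    · simp; omega
    · rw [← h5, Nat.succ_eq_add_one, Nat.add_sub_cancel, pow_succ]; ring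
    · rw [Nat.succ_eq_add_one, Nat.add_sub_cancel]
      push_cast at hc
      linarith
    · omega
  · refine ⟨h.frame (fun x hx => ?_) rfl, ?_, ?_, ?_, ?_, ?_⟩
    · simp [State.setReg, State.pay, (show x ≠ 5 by omega)]
    all_goals simp [State.setReg, State.pay]
  · simpa [State.setReg, State.pay] using hf
  · rintro _ ⟨t, rfl, ⟨hb, h2, h3, h6, h5, hc⟩, h0⟩
    refine ⟨hb.frame (fun _ _ => rfl) rfl, h2, h3, ?_, ?_⟩
    · rw [h0, pow_zero, mul_one] at h5; exact h5
    · rw [h0] at hc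
      simp only [State.pay]
      push_cast at hc
      linarith

/-- For every `l < reg 3`, run `reg 5` trials with extension size `l`. -/
def search {L : Finset (ℝ × ℝ)} (p : L) (w b : ℕ) : Prog L :=
  .loop 3 (.seq (.sub 3 3 1) (.seq (.copy 4 5) (trials p w b)))

/-- The invariant of the loop of `search`. -/
structure SearchInv {n : ℕ} (F : Set (Finset (Fin n))) (K : ℝ) (s t : State) : Prop where
  best : BestInv F t
  reg5 : t.reg 5 = s.reg 5
  reg3 : t.reg 3 ≤ s.reg 3
  le : t.reg 2 ≤ s.reg 2
  cost : t.cost + t.reg 3 * K ≤ s.cost + s.reg 3 * K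

/-- The cost of the trials with one extension size. -/
def roundCost (c : ℝ) (n b l N : ℕ) : ℝ := N * (trialCost c n b l + 2) + 4

theorem trialCost_mono {c : ℝ} (hc : 1 ≤ c) (n b : ℕ) {l l' : ℕ} (h : l ≤ l') :
    trialCost c n b l ≤ trialCost c n b l' :=
  add_le_add le_rfl (pow_le_pow_right₀ hc h)

/-- The state in which the trials with the next extension size start. -/
def roundState (t : State) : State :=
  { t with
    reg := Function.update (Function.update t.reg 3 (t.reg 3 - t.reg 1)) 4 (t.reg 5)
    cost := t.cost + 3 }

theorem run_search_step {L : Finset (ℝ × ℝ)} {n : ℕ} (O : L → Oracle n) (fuel : ℕ) (p : L)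
    (w b : ℕ) (t : State) :
    (.seq (.sub 3 3 1) (.seq (.copy 4 5) (trials p w b)) : Prog L).run O fuel (t.pay 1) =
      (trials p w b).run O fuel (roundState t) := by
  rw [Prog.run, Prog.run, andThen_pure_some, Prog.run, Prog.run, andThen_pure_some]
  congr 1
  simp [State.setReg, State.pay, roundState]
  ring

theorem BestInv.roundState {n : ℕ} {F : Set (Finset (Fin n))} {t : State} (h : BestInv F t) :
    BestInv F (roundState t) := by
  refine h.frame (fun x hx => ?_) rfl
  simp [SubsetMin.roundState, (show x ≠ 3 by omega), (show x ≠ 4 by omega)]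

theorem safe_search_step {L : Finset (ℝ × ℝ)} {n : ℕ} {O : L → Oracle n} {fuel : ℕ}
    (hf : n < fuel) {F : Set (Finset (Fin n))} (p : L) (hc : 1 ≤ p.1.2)
    (hO : IsExtensionOracle F p.1.1 (O p)) {w b : ℕ} (hw : w ≤ 2 ^ b) {s t : State} {M : ℕ}
    (hM : s.reg 3 = M + 1) (h5 : s.reg 5 < fuel)
    (ht : SearchInv F (roundCost p.1.2 n b M (s.reg 5)) s t) (h3 : t.reg 3 ≠ 0) :
    Safe ((trials p w b).run O fuel (roundState t)) fun t' =>
      SearchInv F (roundCost p.1.2 n b M (s.reg 5)) s t' ∧ t'.reg 3 = t.reg 3 - 1 ∧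
        t'.reg 2 ≤ t.reg 2 := by
  obtain ⟨r, hr⟩ := Nat.exists_eq_succ_of_ne_zero h3
  have h1 := ht.best.one
  have e3 : (roundState t).reg 3 = r := by simp [roundState, h1, hr]
  have e4 : (roundState t).reg 4 = s.reg 5 := by simp [roundState, ht.reg5]
  refine (safe_trials hf p hO hw ht.best.roundState (by omega)).mono ?_
  rintro u ⟨hu, hreg, hle, hcost⟩
  have hu3 := (hreg 3 (by omega) (by omega) (by omega)).trans e3
  have hu5 := hreg 5 (by omega) (by omega) (by omega)
  have hrM : r ≤ M := by have := ht.reg3; omega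
  rw [e3, e4] at hcost
  have hle' : u.reg 2 ≤ t.reg 2 := by simpa [roundState] using hle
  refine ⟨⟨hu, ?_, ?_, hle'.trans ht.le, ?_⟩, by omega, hle'⟩
  · rw [hu5, ← ht.reg5]; simp [roundState]
  · have := ht.reg3; omega
  · have h := ht.cost
    have hmono := mul_le_mul_of_nonneg_left (trialCost_mono hc n b hrM)
      (Nat.cast_nonneg (α := ℝ) (s.reg 5))
    rw [hr] at h
    rw [hu3]
    simp only [roundState, roundCost] at hcost h ⊢
    push_cast at h
    linarith

theorem safe_search {L : Finset (ℝ × ℝ)} {n : ℕ} {O : L → Oracle n} {fuel : ℕ}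
    (hf : n < fuel) {F : Set (Finset (Fin n))} (p : L) (hc : 1 ≤ p.1.2)
    (hO : IsExtensionOracle F p.1.1 (O p)) {w b : ℕ} (hw : w ≤ 2 ^ b) {s : State} {M : ℕ}
    (hM : s.reg 3 = M + 1) (hMf : M + 1 < fuel) (h5 : s.reg 5 < fuel) (h : BestInv F s) :
    Safe ((search p w b).run O fuel s) fun t => BestInv F t ∧ t.reg 2 ≤ s.reg 2 ∧
      t.cost ≤ s.cost + ((M + 1) * roundCost p.1.2 n b M (s.reg 5) + 1) := by
  rw [search, Prog.run]
  refine (safe_runLoop (SearchInv F (roundCost p.1.2 n b M (s.reg 5)) s) (fun t ht h0 => ?_) fuel s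
    ⟨h, rfl, le_rfl, le_rfl, le_rfl⟩ (by omega)).mono ?_
  · rw [run_search_step]
    exact (safe_search_step hf p hc hO hw hM h5 ht h0).mono fun t' ht' => ⟨ht'.1, by omega⟩
  · rintro _ ⟨t, rfl, ht, h0⟩
    have hcost := ht.cost
    rw [h0, hM] at hcost
    refine ⟨ht.best.frame (fun _ _ => rfl) rfl, ht.le, ?_⟩
    simp only [State.pay]
    push_cast at hcost
    linarith

/-- Only the round with length `l` is relied upon; the others cannot spoil its result because the
best solution never gets worse. -/
theorem expect_search_le {L : Finset (ℝ × ℝ)} {n : ℕ} {O : L → Oracle n} {fuel : ℕ}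
    (hf : n < fuel) {F : Set (Finset (Fin n))} (p : L) (hc : 1 ≤ p.1.2)
    (hO : IsExtensionOracle F p.1.1 (O p)) {w b : ℕ} (hw : w ≤ 2 ^ b) {s : State} {M : ℕ}
    (hM : s.reg 3 = M + 1) (hMf : M + 1 < fuel) (h5 : s.reg 5 < fuel) (h : BestInv F s)
    {B : ℝ} {y : ENNReal} {l : ℕ} (hl : l ≤ M)
    (hy : ∀ t, BestInv F t → t.reg 3 = l → t.reg 4 = s.reg 5 →
      expect ((trials p w b).run O fuel t) (bad B) ≤ y) :
    expect ((search p w b).run O fuel s) (bad B) ≤ y := by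
  rw [search, Prog.run]
  -- The factor is `y` while round `l` is still ahead and 1 afterwards.
  refine (expect_runLoop_le (SearchInv F (roundCost p.1.2 n b M (s.reg 5)) s)
    (fun t => (if l < t.reg 3 then y else 1) * bad B t) (fun t ht h0 => ?_) (fun t ht h0 => ?_)
    (fun t ht h0 => ?_) fuel s ⟨h, rfl, le_rfl, le_rfl, le_rfl⟩ (by omega)).trans ?_
  · rw [run_search_step]
    exact (safe_search_step hf p hc hO hw hM h5 ht h0).mono fun t' ht' => ⟨ht'.1, by omega⟩
  · rw [h0, if_neg (by omega), one_mul]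
    exact le_of_eq rfl
  · rw [run_search_step]
    have hsafe := safe_search_step hf p hc hO hw hM h5 ht h0
    by_cases hB : (t.reg 2 : ℝ) ≤ B
    · refine hsafe.expect_le fun t' ht' => ?_
      rw [bad_of_le ((Nat.cast_le.2 ht'.2.2).trans hB), mul_zero]
      exact zero_le
    · rw [bad_of_not_le hB, mul_one]
      -- The body decrements the register before the trials, so round `l` is the one entered with
      -- `reg 3 = l + 1`.
      rcases lt_trichotomy (l + 1) (t.reg 3) with hlt | heq | hgt
      · refine hsafe.expect_le fun t' ht' => ?_
        rw [if_pos (by omega), if_pos (by omega)]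
        exact (mul_le_mul_right (bad_le_one _ _) _).trans (mul_one _).le
      · rw [if_pos (by omega)]
        refine (hsafe.expect_mono (g' := bad B) fun t' ht' => ?_).trans
          (hy _ ht.best.roundState ?_ ?_)
        · rw [if_neg (by omega), one_mul]
        · simp [roundState, ht.best.one, ← heq]
        · simp [roundState, ht.reg5]
      · refine hsafe.expect_le fun t' ht' => ?_
        rw [if_neg (by omega), if_neg (by omega), one_mul]
        exact bad_le_one _ _
  · rw [if_pos (by omega)]
    exact (mul_le_mul_right (bad_le_one B s) _).trans (mul_one _).le

/-- `search` covers the lengths strictly below `reg 3`; adding 1 includes `maxLen` itself. -/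
def phase {L : Finset (ℝ × ℝ)} (p : L) (S : Strategy) : Prog L :=
  .seq (exponents S.m S.e S.f S.a) (.seq power (.seq (.add 3 3 1) (search p S.w S.b)))

namespace Strategy

def cost (S : Strategy) (c : ℝ) (n : ℕ) : ℝ :=
  (S.maxLen n + 1) * roundCost c n S.b (S.maxLen n) (S.reps n) +
    (4 * n + 3 * (S.e * S.blocks n + S.a : ℕ) + 11)

/-- A common bound for the loops over elements, over trials, over lengths, and over the exponent of
`reps`. -/
def fuel (S : Strategy) (n : ℕ) : ℕ := n + S.reps n + S.maxLen n + 2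

theorem exponent_lt_reps (S : Strategy) (n : ℕ) : S.e * S.blocks n + S.a < S.reps n :=
  Nat.lt_two_pow_self

end Strategy

theorem BestInv.addState {n : ℕ} {F : Set (Finset (Fin n))} {t : State} (h : BestInv F t) (v : ℕ) :
    BestInv F ((t.setReg 3 v).pay 1) := by
  refine h.frame (fun x hx => ?_) rfl
  simp [State.setReg, State.pay, (show x ≠ 3 by omega)]

theorem safe_phase {L : Finset (ℝ × ℝ)} {n : ℕ} {O : L → Oracle n} {fuel : ℕ}
    {F : Set (Finset (Fin n))} (p : L) (hc : 1 ≤ p.1.2) (hO : IsExtensionOracle F p.1.1 (O p))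
    (S : Strategy) (hf : S.fuel n ≤ fuel) {s : State} (h : BestInv F s) :
    Safe ((phase p S).run O fuel s) fun t => BestInv F t ∧ t.reg 2 ≤ s.reg 2 ∧
      t.cost ≤ s.cost + S.cost p.1.2 n := by
  have he := S.exponent_lt_reps n
  unfold Strategy.fuel at hf
  rw [phase, Prog.run]
  refine (safe_exponents O (by omega) S h).andThen fun t ⟨ht, h2, h3, h6, hcost⟩ => ?_
  rw [Prog.run]
  refine (safe_power O ht (by omega)).andThen fun u ⟨hu, hu2, hu3, hu5, hucost⟩ => ?_
  rw [Prog.run, Prog.run, andThen_pure_some]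
  have hu5' : u.reg 5 = S.reps n := by rw [hu5, h6]; rfl
  refine (safe_search (by omega) p hc hO S.w_le (M := S.maxLen n) ?_ (by omega) ?_
    (hu.addState _)).mono fun v ⟨hv, hv2, hvcost⟩ => ⟨hv, ?_, ?_⟩
  · simp [State.setReg, State.pay, hu3, h3, hu.one]
  · simp [State.setReg, State.pay, hu5']; omega
  · simp only [State.setReg, State.pay, ne_eq, Nat.reduceEqDiff, not_false_eq_true,
      Function.update_of_ne] at hv2
    omega
  · simp only [State.setReg, State.pay, ne_eq, Nat.reduceEqDiff, not_false_eq_true,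
      Function.update_of_ne, hu5'] at hvcost
    rw [h6] at hucost
    unfold Strategy.cost
    linarith

theorem expect_phase_le {L : Finset (ℝ × ℝ)} {n : ℕ} {O : L → Oracle n} {fuel : ℕ}
    {F : Set (Finset (Fin n))} (hM : IsMonotoneSystem F) (p : L) (hc : 1 ≤ p.1.2)
    (hO : IsExtensionOracle F p.1.1 (O p))
    (S : Strategy) (hf : S.fuel n ≤ fuel) {s : State} (h : BestInv F s) {β : ℝ}
    {T : Finset (Fin n)} (hT : T ∈ F) (hS : S.Works p.1.1 β n T.card) :
    expect ((phase p S).run O fuel s) (bad (β * T.card)) ≤ 2⁻¹ := by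
  have he := S.exponent_lt_reps n
  unfold Strategy.fuel at hf
  obtain ⟨l, hl, hexp⟩ := exists_expect_trials_le (fuel := fuel) (by omega) hM p hO S hT hS
    (by omega)
  rw [phase, Prog.run, expect_andThen]
  refine (safe_exponents O (by omega) S h).expect_le fun t ⟨ht, h2, h3, h6, hcost⟩ => ?_
  rw [Prog.run, expect_andThen]
  refine (safe_power O ht (by omega)).expect_le fun u ⟨hu, hu2, hu3, hu5, hucost⟩ => ?_
  rw [Prog.run, Prog.run, andThen_pure_some]
  have hu5' : u.reg 5 = S.reps n := by rw [hu5, h6]; rfl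
  have hu5'' : ((u.setReg 3 (u.reg 3 + u.reg 1)).pay 1).reg 5 = S.reps n := by
    simpa [State.setReg, State.pay] using hu5'
  refine expect_search_le (by omega) p hc hO S.w_le (M := S.maxLen n) ?_ (by omega) ?_
    (hu.addState _) hl fun v hv hv3 hv4 => hexp v hv hv3 (hv4.trans hu5'')
  · simp [State.setReg, State.pay, hu3, h3, hu.one]
  · rw [hu5'']; omega

def phases {L : Finset (ℝ × ℝ)} (p : L) : List Strategy → Prog L
  | [] => .skip
  | S :: l => .seq (phase p S) (phases p l)

theorem safe_phases {L : Finset (ℝ × ℝ)} {n : ℕ} {O : L → Oracle n} {fuel : ℕ}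
    {F : Set (Finset (Fin n))} (p : L) (hc : 1 ≤ p.1.2) (hO : IsExtensionOracle F p.1.1 (O p))
    (l : List Strategy) (hf : ∀ S ∈ l, S.fuel n ≤ fuel) {s : State} (h : BestInv F s) :
    Safe ((phases p l).run O fuel s) fun t => BestInv F t ∧ t.reg 2 ≤ s.reg 2 ∧
      t.cost ≤ s.cost + (l.map fun S => S.cost p.1.2 n).sum := by
  induction l generalizing s with
  | nil => simpa [phases, Prog.run] using h
  | cons S l ih =>
    rw [phases, Prog.run]
    refine (safe_phase p hc hO S (hf S (by simp)) h).andThen fun t ⟨ht, h2, hcost⟩ => ?_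
    refine (ih (fun S' hS' => hf S' (by simp [hS'])) ht).mono fun u ⟨hu, hu2, hucost⟩ =>
      ⟨hu, hu2.trans h2, ?_⟩
    rw [List.map_cons, List.sum_cons]
    linarith

theorem expect_phases_of_le {L : Finset (ℝ × ℝ)} {n : ℕ} {O : L → Oracle n} {fuel : ℕ}
    {F : Set (Finset (Fin n))} (p : L) (hc : 1 ≤ p.1.2) (hO : IsExtensionOracle F p.1.1 (O p))
    (l : List Strategy) (hf : ∀ S ∈ l, S.fuel n ≤ fuel) {s : State} (h : BestInv F s) {B : ℝ}
    (hB : (s.reg 2 : ℝ) ≤ B) : expect ((phases p l).run O fuel s) (bad B) ≤ 0 :=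
  (safe_phases p hc hO l hf h).expect_le fun _ ht =>
    (bad_of_le ((Nat.cast_le.2 ht.2.1).trans hB)).le

theorem expect_phases_le {L : Finset (ℝ × ℝ)} {n : ℕ} {O : L → Oracle n} {fuel : ℕ}
    {F : Set (Finset (Fin n))} (hM : IsMonotoneSystem F) (p : L) (hc : 1 ≤ p.1.2)
    (hO : IsExtensionOracle F p.1.1 (O p)) (l : List Strategy) (hf : ∀ S ∈ l, S.fuel n ≤ fuel)
    {s : State} (h : BestInv F s) {β : ℝ} {T : Finset (Fin n)} (hT : T ∈ F)
    (hS : ∃ S ∈ l, S.Works p.1.1 β n T.card) :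
    expect ((phases p l).run O fuel s) (bad (β * T.card)) ≤ 2⁻¹ := by
  induction l generalizing s with
  | nil => simp at hS
  | cons S l ih =>
    rw [phases, Prog.run, expect_andThen]
    have hf' : ∀ S' ∈ l, S'.fuel n ≤ fuel := fun S' hS' => hf S' (by simp [hS'])
    have hsafe := safe_phase p hc hO S (hf S (by simp)) h
    -- If a later strategy works, the present phase is irrelevant. Otherwise the present one works,
    -- and the later phases preserve its success.
    by_cases hS' : ∃ S ∈ l, S.Works p.1.1 β n T.card
    · exact hsafe.expect_le fun t ht => ih hf' ht.1 hS'
    · have hW : S.Works p.1.1 β n T.card := by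
        obtain ⟨S', hmem, hW⟩ := hS
        rcases List.mem_cons.1 hmem with rfl | hmem
        · exact hW
        · exact absurd ⟨S', hmem, hW⟩ hS'
      refine (hsafe.expect_mono fun t ht => ?_).trans
        (expect_phase_le hM p hc hO S (hf S (by simp)) h hT hW)
      by_cases hB : (t.reg 2 : ℝ) ≤ β * T.card
      · exact (expect_phases_of_le p hc hO l hf' ht.1 hB).trans zero_le
      · rw [bad_of_not_le hB]
        exact (safe_phases p hc hO l hf' ht.1).expect_le fun u _ => bad_le_one _ u

/-! ### The complete algorithm: approximation and cost. -/

/-- Make the universe the best solution. -/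
def setup {L : Finset (ℝ × ℝ)} : Prog L :=
  .seq (.const 1 1) (.seq (.copy 2 0) (.seq (.copy 8 0)
    (.loop 8 (.seq (.sub 8 8 1) (.store 0 8 1)))))

theorem safe_setup {L : Finset (ℝ × ℝ)} {n : ℕ} (O : L → Oracle n) {fuel : ℕ} (hf : n < fuel)
    {F : Set (Finset (Fin n))} (hM : IsMonotoneSystem F) :
    Safe ((setup : Prog L).run O fuel (State.init n)) fun t => BestInv F t ∧ t.reg 2 = n ∧
      t.cost ≤ 3 * n + 4 := by
  simp only [setup, Prog.run, andThen_pure_some]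
  refine (safe_runLoop (fun t => t.reg 0 = n ∧ t.reg 1 = 1 ∧ t.reg 2 = n ∧
    (∀ i, t.reg 8 ≤ i → i < n → t.arr 0 i ≠ 0) ∧ t.cost + t.reg 8 * 3 ≤ 3 + 3 * n)
    ?_ fuel _ ?_ ?_).mono ?_
  · rintro t ⟨h0, h1, h2, harr, hc⟩ h8
    obtain ⟨r, hr⟩ := Nat.exists_eq_succ_of_ne_zero h8
    rw [safe_pure]
    simp only [State.setReg, State.setArr, State.pay, ne_eq, Nat.reduceEqDiff, not_false_eq_true,
      Function.update_of_ne, Function.update_self, h1]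
    rw [hr] at harr hc ⊢
    refine ⟨⟨by simpa using h0, by simp, by simpa using h2, fun i hi hin => ?_, ?_⟩,
      by omega⟩
    · rw [Function.update_apply]
      split_ifs with h
      · exact not_false
      · exact harr i (by omega) hin
    · rw [Nat.succ_eq_add_one, Nat.add_sub_cancel]
      push_cast at hc
      linarith
  · refine ⟨?_, ?_, ?_, ?_, ?_⟩
    · simp [State.setReg, State.pay, State.init]
    · simp [State.setReg, State.pay]
    · simp [State.setReg, State.pay, State.init]
    · intro i hi
      simp [State.setReg, State.pay, State.init] at hi
      omega
    · simp [State.setReg, State.pay, State.init]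
      linarith
  · simpa [State.setReg, State.pay, State.init] using hf
  · rintro _ ⟨t, rfl, ⟨h0, h1, h2, harr, hc⟩, h8⟩
    have hset : (t.pay 1).getSet n 0 = Finset.univ := by
      ext i
      rw [State.getSet, Finset.mem_filter]
      have h := harr i (by omega) i.2
      simpa [State.pay] using h
    rw [h8] at hc
    refine ⟨⟨h0, h1, hset ▸ hM.univ_mem, ?_⟩, h2, ?_⟩
    · rw [hset, Finset.card_univ, Fintype.card_fin]; exact h2
    · simp only [State.pay]
      push_cast at hc
      linarith

/-- The algorithm that tries the given strategies one after the other. -/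
def algorithm {L : Finset (ℝ × ℝ)} (p : L) (l : List Strategy) : Prog L :=
  .seq setup (phases p l)

/-- A number of loop rounds that suffices for all loops of `algorithm`. -/
def algorithmFuel (l : List Strategy) (n : ℕ) : ℕ := n + 1 + (l.map fun S => S.fuel n).sum

theorem fuel_le_algorithmFuel {l : List Strategy} {n : ℕ} {S : Strategy} (hS : S ∈ l) :
    S.fuel n ≤ algorithmFuel l n := by
  have := List.single_le_sum (l := l.map fun S => S.fuel n) (fun _ _ => Nat.zero_le _) _
    (List.mem_map_of_mem hS)
  unfold algorithmFuel
  omega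

theorem safe_algorithm {L : Finset (ℝ × ℝ)} {n : ℕ} {O : L → Oracle n}
    {F : Set (Finset (Fin n))} (hM : IsMonotoneSystem F) (p : L) (hc : 1 ≤ p.1.2)
    (hO : IsExtensionOracle F p.1.1 (O p)) (l : List Strategy) :
    Safe ((algorithm p l).run O (algorithmFuel l n) (State.init n)) fun t => BestInv F t ∧
      t.cost ≤ 3 * n + 4 + (l.map fun S => S.cost p.1.2 n).sum := by
  rw [algorithm, Prog.run]
  refine (safe_setup O (by unfold algorithmFuel; omega) hM).andThen fun t ⟨ht, _, hcost⟩ => ?_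
  refine (safe_phases p hc hO l (fun S hS => fuel_le_algorithmFuel hS) ht).mono
    fun u ⟨hu, _, hucost⟩ => ⟨hu, by linarith⟩

theorem expect_algorithm_le {L : Finset (ℝ × ℝ)} {n : ℕ} {O : L → Oracle n}
    {F : Set (Finset (Fin n))} (hM : IsMonotoneSystem F) (p : L) (hc : 1 ≤ p.1.2)
    (hO : IsExtensionOracle F p.1.1 (O p)) (l : List Strategy) {β : ℝ}
    {T : Finset (Fin n)} (hT : T ∈ F)
    (hS : (n : ℝ) ≤ β * T.card ∨ ∃ S ∈ l, S.Works p.1.1 β n T.card) :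
    expect ((algorithm p l).run O (algorithmFuel l n) (State.init n)) (bad (β * T.card)) ≤
      2⁻¹ := by
  rw [algorithm, Prog.run, expect_andThen]
  refine (safe_setup O (by unfold algorithmFuel; omega) hM).expect_le fun t ⟨ht, h2, _⟩ => ?_
  rcases hS with hS | hS
  · exact (expect_phases_of_le p hc hO l (fun S hS => fuel_le_algorithmFuel hS) ht
      (by rwa [h2])).trans zero_le
  · exact expect_phases_le hM p hc hO l (fun S hS => fuel_le_algorithmFuel hS) ht hT hS

/-- With `algorithmFuel` no outcome is cut off, so both lower bounds on the supremum over the fuel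
are already attained there. The ratio is checked against a member of minimum size. -/
theorem isApprox_algorithm {α c β : ℝ} (hβ : 0 ≤ β) (hc : 1 ≤ c) (l : List Strategy)
    (hl : ∀ n k : ℕ, k ≤ n → (n : ℝ) ≤ β * k ∨ ∃ S ∈ l, S.Works α β n k) :
    (algorithm (⟨(α, c), Finset.mem_singleton_self _⟩ : ({(α, c)} : Finset (ℝ × ℝ))) l).IsApprox
      β := by
  intro n F O hM hO
  set p : ({(α, c)} : Finset (ℝ × ℝ)) := ⟨(α, c), Finset.mem_singleton_self _⟩
  have hsafe := safe_algorithm hM p hc (hO p) l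
  refine ⟨le_antisymm ?_ ?_, ?_⟩
  · refine iSup_le fun fuel => ?_
    rw [PMF.toOuterMeasure_apply]
    refine (ENNReal.tsum_le_tsum fun o => ?_).trans
      (PMF.tsum_coe ((algorithm p l).run O fuel (State.init n))).le
    exact Set.indicator_le_self _ _ o
  · refine le_trans ?_ (le_iSup _ (algorithmFuel l n))
    rw [((PMF.toOuterMeasure_apply_eq_one_iff _ _).2 fun o ho => ?_)]
    obtain ⟨s, rfl, hs⟩ := hsafe o ho
    exact ⟨s, rfl, hs.1.mem⟩
  · obtain ⟨T, hT, hmin⟩ := (Set.toFinite F).exists_minimalFor Finset.card F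
      ⟨Finset.univ, hM.univ_mem⟩
    refine le_trans ?_ (le_iSup _ (algorithmFuel l n))
    refine le_trans ?_ (hsafe.le_toOuterMeasure (bad (β * T.card)) (fun s hs hbad => ?_)
      (expect_algorithm_le hM p hc (hO p) l hT
        (hl n T.card (by simpa using Finset.card_le_univ T))))
    · simp
    · rw [bad_of_not_le]
      intro hle
      refine hbad fun T' hT' => ?_
      have h2 : ((s.output n).card : ℝ) = s.reg 2 := by rw [hs.1.card]; rfl
      rw [h2]
      refine hle.trans (mul_le_mul_of_nonneg_left ?_ hβ)
      rcases le_total T.card T'.card with h | h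
      · exact_mod_cast h
      · exact_mod_cast hmin hT' h

theorem hasCost_algorithm {α c : ℝ} (hc : 1 ≤ c) (l : List Strategy) {f : ℕ → ℝ}
    (hf : Monotone f) (hl : ∀ n : ℕ, 3 * n + 4 + (l.map fun S => S.cost c n).sum ≤ f n) :
    (algorithm (⟨(α, c), Finset.mem_singleton_self _⟩ : ({(α, c)} : Finset (ℝ × ℝ))) l).HasCost
      f := by
  intro n N hN F O hM hO
  set p : ({(α, c)} : Finset (ℝ × ℝ)) := ⟨(α, c), Finset.mem_singleton_self _⟩
  refine ⟨algorithmFuel l N, fun o ho => ?_⟩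
  obtain ⟨s, rfl, hs⟩ := safe_algorithm hM p hc (hO p) l o ho
  exact ⟨s, rfl, hs.2.trans ((hl N).trans (hf hN))⟩

/-! ### Lower bounds for binomial probabilities. -/

/-- The ratio of consecutive binomial probabilities without denominators: the sequence does not
decrease from `i` to `i + 1` when `i + 1 ≤ (k + 1) * q`, and does not increase otherwise. -/
theorem binomial_step (k i : ℕ) (hi : i < k) (q : ℝ) :
    ((k.choose (i + 1) : ℝ) * (q ^ (i + 1) * (1 - q) ^ (k - (i + 1)))) * ((i + 1) * (1 - q)) =
      ((k.choose i : ℝ) * (q ^ i * (1 - q) ^ (k - i))) * ((k - i) * q) := by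
  have h : (k.choose (i + 1) : ℝ) * (i + 1) = k.choose i * (k - i) := by
    have := Nat.choose_succ_right_eq k i
    rw [← Nat.cast_sub hi.le]
    exact_mod_cast this
  have e : k - i = k - (i + 1) + 1 := by omega
  rw [e, pow_succ, pow_succ]
  linear_combination (q ^ i * q * (1 - q) ^ (k - (i + 1)) * (1 - q)) * h

/-- The largest of the `k + 1` binomial probabilities is the one at `⌊(k + 1) q⌋`. -/
theorem one_le_mul_binomial_mode (k : ℕ) {q : ℝ} (h0 : 0 < q) (h1 : q < 1) :
    1 ≤ (k + 1 : ℝ) * ((k.choose ⌊(k + 1) * q⌋₊ : ℝ) *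
      (q ^ ⌊(k + 1) * q⌋₊ * (1 - q) ^ (k - ⌊(k + 1) * q⌋₊))) := by
  set m := ⌊(k + 1) * q⌋₊ with hm
  set f : ℕ → ℝ := fun i => (k.choose i : ℝ) * (q ^ i * (1 - q) ^ (k - i)) with hf
  have h1' : 0 < 1 - q := sub_pos.2 h1
  have hpos : ∀ i, 0 ≤ f i := fun i => by simp only [hf]; positivity
  have hmk : m ≤ k := by
    have : m < k + 1 := by
      rw [hm, Nat.floor_lt (by positivity)]
      push_cast
      nlinarith [(Nat.cast_nonneg k : (0 : ℝ) ≤ k)]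
    omega
  have hup : ∀ i < m, f i ≤ f (i + 1) := by
    intro i hi
    have hle : ((i + 1 : ℕ) : ℝ) ≤ (k + 1) * q :=
      (Nat.le_floor_iff (by positivity)).1 (by omega)
    push_cast at hle
    have hs := binomial_step k i (by omega) q
    have hp : 0 < (i + 1 : ℝ) * (1 - q) := by positivity
    refine le_of_mul_le_mul_right ?_ hp
    refine le_trans ?_ hs.ge
    exact mul_le_mul_of_nonneg_left (by linarith) (hpos i)
  have hdown : ∀ i, m ≤ i → i < k → f (i + 1) ≤ f i := by
    intro i hi hik
    have hlt : (k + 1) * q < i + 1 := by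
      have := Nat.lt_of_floor_lt (show ⌊(k + 1) * q⌋₊ < i + 1 by omega)
      exact_mod_cast this
    have hs := binomial_step k i hik q
    have hp : 0 < (i + 1 : ℝ) * (1 - q) := by positivity
    refine le_of_mul_le_mul_right ?_ hp
    refine hs.le.trans ?_
    exact mul_le_mul_of_nonneg_left (by linarith) (hpos i)
  have hle : ∀ i ≤ k, f i ≤ f m := by
    intro i hik
    rcases le_total i m with him | him
    · refine Nat.decreasingInduction' (P := fun j => f j ≤ f m) (fun j hj _ ih => ?_) him le_rfl
      exact (hup j hj).trans ih
    · clear_value m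
      induction i, him using Nat.le_induction with
      | base => exact le_rfl
      | succ j hj ih => exact (hdown j hj (by omega)).trans (ih (by omega))
  have hsum : ∑ i ∈ Finset.range (k + 1), f i = 1 := by
    have := add_pow q (1 - q) k
    rw [add_sub_cancel, one_pow] at this
    rw [this]
    exact Finset.sum_congr rfl fun i _ => by simp only [hf]; ring
  calc (1 : ℝ) = ∑ i ∈ Finset.range (k + 1), f i := hsum.symm
    _ ≤ ∑ i ∈ Finset.range (k + 1), f m :=
      Finset.sum_le_sum fun i hi => hle i (by have := Finset.mem_range.1 hi; omega)
    _ = (k + 1) * f m := by simp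

/-- The constant in the lower bound for binomial probabilities. -/
def tiltConst (q p : ℝ) : ℝ := |Real.log (q / p)| + |Real.log ((1 - q) / (1 - p))|

theorem floor_mode_bounds (k : ℕ) {q : ℝ} (h0 : 0 < q) (h1 : q < 1) :
    ⌊(k + 1) * q⌋₊ ≤ k ∧ (⌊(k + 1) * q⌋₊ : ℝ) ≤ k * q + 1 ∧ k * q - 1 ≤ ⌊(k + 1) * q⌋₊ := by
  have hk : (0 : ℝ) ≤ k := Nat.cast_nonneg k
  have hl := Nat.floor_le (show (0 : ℝ) ≤ (k + 1) * q by positivity)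
  have hu := Nat.lt_floor_add_one ((k + 1 : ℝ) * q)
  refine ⟨?_, by linarith, by linarith⟩
  have : ⌊(k + 1) * q⌋₊ < k + 1 := by
    rw [Nat.floor_lt (by positivity)]
    push_cast
    nlinarith
  omega

/-- Change of measure at the mode `m` for parameter `q`, whose probability under `q` is at least `1
/ (k + 1)`. Passing from `q` to `p` multiplies it by `exp (-(m * A + (k - m) * A'))`, and `|m - k *
q| ≤ 1` bounds the deviation of the exponent from `k * klBernoulli q p` by `tiltConst q p`. -/
theorem exp_le_binomial (k : ℕ) {q p : ℝ} (hq0 : 0 < q) (hq1 : q < 1) (hp0 : 0 < p) (hp1 : p < 1) :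
    Real.exp (-(k * klBernoulli q p + tiltConst q p)) ≤
      (k + 1 : ℝ) * ((k.choose ⌊(k + 1) * q⌋₊ : ℝ) *
        (p ^ ⌊(k + 1) * q⌋₊ * (1 - p) ^ (k - ⌊(k + 1) * q⌋₊))) := by
  obtain ⟨hmk, hm1, hm2⟩ := floor_mode_bounds k hq0 hq1
  have hmode := one_le_mul_binomial_mode k hq0 hq1
  set m := ⌊(k + 1) * q⌋₊ with hm
  have hq1' : 0 < 1 - q := sub_pos.2 hq1
  have hp1' : 0 < 1 - p := sub_pos.2 hp1
  set A := Real.log (q / p) with hA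
  set A' := Real.log ((1 - q) / (1 - p)) with hA'
  have eA : p = q * Real.exp (-A) := by
    rw [hA, Real.exp_neg, Real.exp_log (by positivity)]; field_simp
  have eA' : 1 - p = (1 - q) * Real.exp (-A') := by
    rw [hA', Real.exp_neg, Real.exp_log (by positivity)]; field_simp
  have hpow : p ^ m * (1 - p) ^ (k - m) =
      q ^ m * (1 - q) ^ (k - m) * Real.exp (-(m * A + (k - m) * A')) := by
    rw [eA', mul_pow, ← Real.exp_nat_mul, Nat.cast_sub hmk]
    nth_rw 1 [eA]
    rw [mul_pow, ← Real.exp_nat_mul, show -(m * A + (k - m) * A') = m * -A + (k - m) * -A' by ring,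
      Real.exp_add]
    ring
  have hexp : m * A + (k - m) * A' ≤ k * klBernoulli q p + tiltConst q p := by
    have hd : |(m : ℝ) - k * q| ≤ 1 := abs_le.2 ⟨by linarith, by linarith⟩
    have h : ((m : ℝ) - k * q) * (A - A') ≤ |A| + |A'| := by
      refine (le_abs_self _).trans ?_
      rw [abs_mul]
      refine (mul_le_mul_of_nonneg_right hd (abs_nonneg _)).trans ?_
      rw [one_mul]
      exact abs_sub _ _
    have e : m * A + (k - m) * A' = k * klBernoulli q p + ((m : ℝ) - k * q) * (A - A') := by
      simp only [klBernoulli, ← hA, ← hA']; ring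
    rw [e, tiltConst]
    linarith
  calc _ ≤ Real.exp (-(m * A + (k - m) * A')) := Real.exp_le_exp.2 (by linarith)
    _ ≤ ((k + 1 : ℝ) * ((k.choose m : ℝ) * (q ^ m * (1 - q) ^ (k - m)))) *
        Real.exp (-(m * A + (k - m) * A')) :=
      le_mul_of_one_le_left (Real.exp_pos _).le hmode
    _ = _ := by rw [hpow]; ring

theorem klBernoulli_nonneg {q p : ℝ} (hq0 : 0 < q) (hq1 : q < 1) (hp0 : 0 < p) (hp1 : p < 1) :
    0 ≤ klBernoulli q p := by
  have hq1' : 0 < 1 - q := sub_pos.2 hq1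
  have hp1' : 0 < 1 - p := sub_pos.2 hp1
  have h1 := Real.one_sub_inv_le_log_of_pos (show 0 < q / p by positivity)
  have h2 := Real.one_sub_inv_le_log_of_pos (show 0 < (1 - q) / (1 - p) by positivity)
  have h1' := mul_le_mul_of_nonneg_left h1 hq0.le
  have h2' := mul_le_mul_of_nonneg_left h2 hq1'.le
  have e1 : q * (1 - (q / p)⁻¹) = q - p := by field_simp
  have e2 : (1 - q) * (1 - ((1 - q) / (1 - p))⁻¹) = p - q := by field_simp; ring
  unfold klBernoulli
  linarith

/-! ### From inequalities between exponents to strategies. -/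

/-- All but finitely many instances in which the smallest solution has a proportion in `K` of the
elements are solved by one of finitely many strategies of cost less than `d ^ n`. -/
def Covered (α β c d : ℝ) (K : Set ℝ) : Prop :=
  ∃ l : List Strategy, (∀ S ∈ l, 2 ^ S.e * c ^ S.f < d ^ S.m) ∧
    ∃ n₀ : ℕ, ∀ n, n₀ ≤ n → 0 < n → ∀ k, k ≤ n → (k / n : ℝ) ∈ K → ∃ S ∈ l, S.Works α β n k

/-- The conditions, with slack `ε`, under which sampling with a given probability, with
proportions `q₁` and `q₂` chosen inside and outside of the smallest solution, succeeds. -/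
structure Slack (α β c d q₁ q₂ v Λ₁ Λ₂ ε κ : ℝ) : Prop where
  length : κ * (1 - q₁) + ε < v
  size : κ * q₁ + (1 - κ) * q₂ + α * v + ε < β * κ
  rate : v * Real.log c + κ * Λ₁ + (1 - κ) * Λ₂ + ε < Real.log d

theorem exists_poly_le_exp {ε : ℝ} (hε : 0 < ε) (B : ℝ) :
    ∃ n₀ : ℕ, ∀ n : ℕ, n₀ ≤ n → B * (n + 1) ^ 2 ≤ Real.exp (n * ε) := by
  -- Here 24 = 4 · 3!: the 4 from `(n + 1) ^ 2 ≤ 4 * n ^ 2`, the 3! from the cubic term of the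
  -- exponential series.
  obtain ⟨n₀, hn₀⟩ := exists_nat_ge (24 * |B| / ε ^ 3 + 1)
  refine ⟨n₀, fun n hn => ?_⟩
  have hnn : (n₀ : ℝ) ≤ n := Nat.cast_le.2 hn
  have hB := abs_nonneg B
  have hq : 0 ≤ 24 * |B| / ε ^ 3 := by positivity
  have hn1 : (1 : ℝ) ≤ n := by linarith
  have h1 : 24 * |B| ≤ n * ε ^ 3 := by
    rw [← div_le_iff₀ (by positivity)]; linarith
  have h2 := Real.pow_div_factorial_le_exp (n * ε) (by positivity) 3
  have h3 : ((n : ℝ) + 1) ^ 2 ≤ 4 * n ^ 2 := by nlinarith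
  calc B * (n + 1) ^ 2 ≤ |B| * (4 * n ^ 2) :=
        mul_le_mul (le_abs_self B) h3 (by positivity) hB
    _ ≤ (n * ε) ^ 3 / 6 := by nlinarith [mul_le_mul_of_nonneg_right h1 (sq_nonneg (n : ℝ))]
    _ ≤ _ := by simpa [Nat.factorial] using h2

/-- One strategy serves the whole set, since it depends on `ε` but not on `κ`. In the rate, half of
`ε` pays for rounding `e` and `f`, the other half for the polynomial loss in the binomial bounds. -/
theorem covered_slack {α β c d q₁ q₂ v ε : ℝ} (hα : 0 ≤ α) (hc : 1 < c) (hd : 1 < d) (hv : 0 ≤ v)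
    (hε : 0 < ε) {w b : ℕ} (hw0 : 0 < w) (hw1 : w < 2 ^ b) (hq₁ : q₁ ∈ Set.Ioo 0 1)
    (hq₂ : q₂ ∈ Set.Ioo 0 1) :
    Covered α β c d {κ | Slack α β c d q₁ q₂ v (klBernoulli q₁ (w / 2 ^ b))
      (klBernoulli q₂ (w / 2 ^ b)) ε κ} := by
  set p : ℝ := w / 2 ^ b with hp
  have hp0 : 0 < p := by rw [hp]; positivity
  have hp1 : p < 1 := by rw [hp, div_lt_one (by positivity)]; exact_mod_cast hw1
  have hp1' : 0 < 1 - p := sub_pos.2 hp1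
  set Λ₁ := klBernoulli q₁ p
  set Λ₂ := klBernoulli q₂ p
  have hΛ₁ : 0 ≤ Λ₁ := klBernoulli_nonneg hq₁.1 hq₁.2 hp0 hp1
  have hΛ₂ : 0 ≤ Λ₂ := klBernoulli_nonneg hq₂.1 hq₂.2 hp0 hp1
  have hlc : 0 < Real.log c := Real.log_pos hc
  have hl2 : 0 < Real.log 2 := Real.log_pos (by norm_num)
  have hld : 0 < Real.log d := Real.log_pos hd
  -- `exp (n * R)` is the number of repetitions that the budget leaves beside the price `c ^ (v *
  -- n)` of a query. If `R < 0`, no `κ` in `[0, 1]` satisfies the rate condition.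
  set R : ℝ := Real.log d - ε / 2 - v * Real.log c with hR
  by_cases hR0 : R < 0
  · refine ⟨[], by simp, 0, fun n _ hn k hk hκ => ?_⟩
    have hn' : (0 : ℝ) < n := Nat.cast_pos.2 hn
    have h0 : (0 : ℝ) ≤ k / n := by positivity
    have h1 : (k / n : ℝ) ≤ 1 := by rw [div_le_one hn']; exact_mod_cast hk
    have := hκ.rate
    have e1 := mul_nonneg h0 hΛ₁
    have e2 := mul_nonneg (sub_nonneg.2 h1) hΛ₂
    linarith
  push Not at hR0
  -- Rounding up `e` and `f` costs at most `log 2 + log c` per block of `m` elements, which must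
  -- stay below `m * ε / 2`.
  obtain ⟨m, hm⟩ := exists_nat_gt ((Real.log 2 + Real.log c) / (ε / 2))
  have hm' : Real.log 2 + Real.log c < m * (ε / 2) := by
    rwa [div_lt_iff₀ (by positivity)] at hm
  have hm0 : 0 < m := by
    rcases Nat.eq_zero_or_pos m with rfl | h
    · push_cast at hm'; linarith
    · exact h
  have hmR : (0 : ℝ) < m := Nat.cast_pos.2 hm0
  set f := ⌈v * m⌉₊ with hf
  set e := ⌈m * R / Real.log 2⌉₊ with he
  have hf1 : v * m ≤ f := Nat.le_ceil _
  have hf2 : (f : ℝ) < v * m + 1 := Nat.ceil_lt_add_one (by positivity)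
  have he1 : m * R ≤ e * Real.log 2 := by
    rw [← div_le_iff₀ hl2]; exact Nat.le_ceil _
  have he2 : e * Real.log 2 < m * R + Real.log 2 := by
    have : (e : ℝ) < m * R / Real.log 2 + 1 := Nat.ceil_lt_add_one (by positivity)
    have h := mul_lt_mul_of_pos_right this hl2
    rwa [add_mul, div_mul_cancel₀ _ hl2.ne', one_mul] at h
  set S : Strategy := ⟨w, b, m, e, f, 0, hw1.le, hm0⟩ with hS
  have hSp : S.prob = p := rfl
  set B := tiltConst q₁ p + tiltConst q₂ p with hB
  obtain ⟨n₁, hn₁⟩ := exists_poly_le_exp (half_pos hε) (2 * Real.exp B)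
  -- Rounding changes `i`, `j` and `l` by at most 1 each, hence the size bound `i + j + α * l` by at
  -- most `2 + α`.
  obtain ⟨n₂, hn₂⟩ := exists_nat_ge ((2 + α) / ε)
  refine ⟨[S], ?_, max n₁ n₂, fun n hn hn0 k hk hκ => ⟨S, by simp, ?_⟩⟩
  · intro S' hS'
    rw [List.mem_singleton.1 hS']
    have hpos : (0 : ℝ) < c := by linarith
    rw [← Real.log_lt_log_iff (by positivity) (by positivity),
      Real.log_mul (by positivity) (by positivity), Real.log_pow, Real.log_pow, Real.log_pow]
    change (e : ℝ) * Real.log 2 + f * Real.log c < m * Real.log d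
    have h1 := mul_lt_mul_of_pos_right hf2 hlc
    have h2 : m * R = m * Real.log d - m * (ε / 2) - v * m * Real.log c := by rw [hR]; ring
    linarith
  have hnR : (0 : ℝ) < n := Nat.cast_pos.2 hn0
  obtain ⟨hlen, hsize, hrate⟩ := hκ
  have hεn : 2 + α ≤ ε * n := by
    have : (2 + α) / ε ≤ n := hn₂.trans (Nat.cast_le.2 ((le_max_right _ _).trans hn))
    rw [div_le_iff₀ hε] at this
    linarith
  have hkn : (k / n : ℝ) * n = k := div_mul_cancel₀ _ hnR.ne'
  have hnk : ((n - k : ℕ) : ℝ) = n - k := Nat.cast_sub hk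
  have hlen' := mul_lt_mul_of_pos_right hlen hnR
  have hsize' := mul_lt_mul_of_pos_right hsize hnR
  have hrate' := mul_lt_mul_of_pos_right hrate hnR
  have el : (k / n * (1 - q₁) + ε) * n = (k / n : ℝ) * n * (1 - q₁) + ε * n := by ring
  have es : (k / n * q₁ + (1 - k / n) * q₂ + α * v + ε) * n =
    (k / n : ℝ) * n * q₁ + (n - (k / n : ℝ) * n) * q₂ + α * (v * n) + ε * n := by ring
  have er : (v * Real.log c + k / n * Λ₁ + (1 - k / n) * Λ₂ + ε) * n =
    v * Real.log c * n + (k / n : ℝ) * n * Λ₁ + (n - (k / n : ℝ) * n) * Λ₂ + ε * n := by ring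
  rw [el, hkn] at hlen'
  rw [es, hkn, mul_assoc β, hkn] at hsize'
  rw [er, hkn] at hrate'
  obtain ⟨hi0, hi1, hi2⟩ := floor_mode_bounds k hq₁.1 hq₁.2
  obtain ⟨hj0, hj1, hj2⟩ := floor_mode_bounds (n - k) hq₂.1 hq₂.2
  have hb1 := exp_le_binomial k hq₁.1 hq₁.2 hp0 hp1
  have hb2 := exp_le_binomial (n - k) hq₂.1 hq₂.2 hp0 hp1
  set i := ⌊(k + 1) * q₁⌋₊
  set j := ⌊((n - k : ℕ) + 1) * q₂⌋₊
  have hl1 : v * n ≤ ⌈v * n⌉₊ := Nat.le_ceil _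
  have hl2' : (⌈v * n⌉₊ : ℝ) < v * n + 1 := Nat.ceil_lt_add_one (by positivity)
  have hblocks : (n : ℝ) ≤ m * S.blocks n := by exact_mod_cast S.le_blocks n
  refine ⟨⌈v * n⌉₊, i, j, ?_, ?_, ?_, ?_⟩
  · rw [Nat.ceil_le, Strategy.maxLen, Nat.cast_mul]
    change v * n ≤ f * (S.blocks n : ℝ)
    calc v * n ≤ v * (m * S.blocks n) := mul_le_mul_of_nonneg_left hblocks hv
      _ = v * m * S.blocks n := by ring
      _ ≤ _ := mul_le_mul_of_nonneg_right hf1 (Nat.cast_nonneg _)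
  · have : (k : ℝ) ≤ i + ⌈v * n⌉₊ := by linarith
    exact_mod_cast this
  · have h := mul_le_mul_of_nonneg_left hl2'.le hα
    rw [hnk] at hj1
    push_cast
    linarith
  · have hsplit : p ^ (i + j) * (1 - p) ^ (n - (i + j)) =
        (p ^ i * (1 - p) ^ (k - i)) * (p ^ j * (1 - p) ^ (n - k - j)) := by
      rw [show n - (i + j) = (k - i) + (n - k - j) by omega, pow_add, pow_add]; ring
    rw [hSp, hsplit]
    set P₁ := (k.choose i : ℝ) * (p ^ i * (1 - p) ^ (k - i))
    set P₂ := ((n - k).choose j : ℝ) * (p ^ j * (1 - p) ^ (n - k - j))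
    have hreps : Real.exp (n * R) ≤ S.reps n := by
      have e1 : (S.reps n : ℝ) = Real.exp (e * S.blocks n * Real.log 2) := by
        rw [← Nat.cast_mul, Real.exp_nat_mul, Real.exp_log (by norm_num)]
        change (((2 : ℕ) ^ (e * S.blocks n + 0) : ℕ) : ℝ) = _
        rw [add_zero, Nat.cast_pow, Nat.cast_ofNat]
      rw [e1]
      refine Real.exp_le_exp.2 ?_
      calc n * R ≤ m * S.blocks n * R := mul_le_mul_of_nonneg_right hblocks hR0
        _ = (m * R) * S.blocks n := by ring
        _ ≤ (e * Real.log 2) * S.blocks n :=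
          mul_le_mul_of_nonneg_right he1 (Nat.cast_nonneg _)
        _ = _ := by ring
    have hpoly := hn₁ n ((le_max_left _ _).trans hn)
    have hkn1 : (0 : ℝ) < k + 1 := by positivity
    have hkn2 : (0 : ℝ) < ((n - k : ℕ) : ℝ) + 1 := by positivity
    have hP : Real.exp (-(n * (R - ε / 2) + B)) ≤ (n + 1) ^ 2 * (P₁ * P₂) := by
      have hmul := mul_le_mul hb1 hb2 (Real.exp_pos _).le (by positivity)
      rw [← Real.exp_add] at hmul
      have hPP : 0 ≤ P₁ * P₂ := by positivity
      calc _ ≤ Real.exp (-(k * Λ₁ + tiltConst q₁ p) + -((n - k : ℕ) * Λ₂ + tiltConst q₂ p)) := by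
            refine Real.exp_le_exp.2 ?_
            rw [hnk, hR, hB]
            linarith
        _ ≤ (k + 1) * P₁ * (((n - k : ℕ) + 1) * P₂) := hmul
        _ = ((k + 1) * ((n - k : ℕ) + 1)) * (P₁ * P₂) := by ring
        _ ≤ (n + 1) ^ 2 * (P₁ * P₂) := by
          refine mul_le_mul_of_nonneg_right ?_ hPP
          rw [sq]
          refine mul_le_mul ?_ ?_ (by positivity) (by positivity)
          · exact_mod_cast Nat.succ_le_succ hk
          · exact_mod_cast Nat.succ_le_succ (Nat.sub_le n k)
    have hfin : 2 * (n + 1 : ℝ) ^ 2 ≤ (n + 1) ^ 2 * (S.reps n * (P₁ * P₂)) := by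
      calc 2 * (n + 1 : ℝ) ^ 2 = 2 * Real.exp B * (n + 1) ^ 2 * Real.exp (-B) := by
            rw [Real.exp_neg]; field_simp
        _ ≤ Real.exp (n * (ε / 2)) * Real.exp (-B) :=
          mul_le_mul_of_nonneg_right hpoly (Real.exp_pos _).le
        _ = Real.exp (n * R) * Real.exp (-(n * (R - ε / 2) + B)) := by
          rw [← Real.exp_add, ← Real.exp_add]; congr 1; ring
        _ ≤ S.reps n * ((n + 1) ^ 2 * (P₁ * P₂)) :=
          mul_le_mul hreps hP (Real.exp_pos _).le (Nat.cast_nonneg _)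
        _ = _ := by ring
    have hn2 : (0 : ℝ) < (n + 1) ^ 2 := by positivity
    have : 2 ≤ S.reps n * (P₁ * P₂) := by
      refine le_of_mul_le_mul_left (le_of_eq_of_le (mul_comm _ _) hfin) hn2
    refine this.trans (le_of_eq ?_)
    ring

/-! ### Dyadic probabilities, neighbourhoods and compactness. -/

open Filter Topology

theorem exists_dyadic_near {p δ : ℝ} (hp0 : 0 < p) (hp1 : p < 1) (hδ : 0 < δ) :
    ∃ w b : ℕ, 0 < w ∧ w < 2 ^ b ∧ |(w / 2 ^ b : ℝ) - p| < δ := by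
  -- Requiring `2⁻ᵇ < p` as well keeps the numerator `⌊p * 2 ^ b⌋₊` positive.
  obtain ⟨b, hb⟩ := exists_pow_lt_of_lt_one (lt_min hδ hp0) (show (1 / 2 : ℝ) < 1 by norm_num)
  have h2 : (0 : ℝ) < 2 ^ b := by positivity
  rw [one_div, inv_pow] at hb
  have hbδ := hb.trans_le (min_le_left _ _)
  have hbp := hb.trans_le (min_le_right _ _)
  have hl := Nat.floor_le (show 0 ≤ p * 2 ^ b by positivity)
  have hu := Nat.lt_floor_add_one (p * 2 ^ b)
  refine ⟨⌊p * 2 ^ b⌋₊, b, ?_, ?_, ?_⟩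
  · rw [Nat.floor_pos]
    have := mul_lt_mul_of_pos_right hbp h2
    rw [inv_mul_cancel₀ h2.ne'] at this
    exact this.le
  · have : (⌊p * 2 ^ b⌋₊ : ℝ) < 2 ^ b := by nlinarith
    exact_mod_cast this
  · rw [abs_lt]
    have e : (⌊p * 2 ^ b⌋₊ : ℝ) / 2 ^ b * 2 ^ b = ⌊p * 2 ^ b⌋₊ := div_mul_cancel₀ _ h2.ne'
    have e' : ((2 : ℝ) ^ b)⁻¹ * 2 ^ b = 1 := inv_mul_cancel₀ h2.ne'
    constructor
    · have : p < (⌊p * 2 ^ b⌋₊ : ℝ) / 2 ^ b + (2 ^ b)⁻¹ := by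
        refine lt_of_mul_lt_mul_right ?_ h2.le
        rw [add_mul, e, e']; exact hu
      linarith
    · have : (⌊p * 2 ^ b⌋₊ : ℝ) / 2 ^ b ≤ p := by
        refine le_of_mul_le_mul_right ?_ h2
        rw [e]; exact hl
      linarith

theorem Covered.mono {α β c d : ℝ} {K K' : Set ℝ} (h : Covered α β c d K') (hK : K ⊆ K') :
    Covered α β c d K := by
  obtain ⟨l, hl, n₀, hn⟩ := h
  exact ⟨l, hl, n₀, fun n hn0 hpos k hk hκ => hn n hn0 hpos k hk (hK hκ)⟩

theorem Covered.union {α β c d : ℝ} {K K' : Set ℝ} (h : Covered α β c d K)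
    (h' : Covered α β c d K') : Covered α β c d (K ∪ K') := by
  obtain ⟨l, hl, n₀, hn⟩ := h
  obtain ⟨l', hl', n₀', hn'⟩ := h'
  refine ⟨l ++ l', fun S hS => ?_, max n₀ n₀', fun n hmax hpos k hk hκ => ?_⟩
  · rcases List.mem_append.1 hS with hS | hS
    · exact hl S hS
    · exact hl' S hS
  · rcases hκ with hκ | hκ
    · obtain ⟨S, hS, hW⟩ := hn n ((le_max_left _ _).trans hmax) hpos k hk hκ
      exact ⟨S, List.mem_append_left _ hS, hW⟩
    · obtain ⟨S, hS, hW⟩ := hn' n ((le_max_right _ _).trans hmax) hpos k hk hκ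
      exact ⟨S, List.mem_append_right _ hS, hW⟩

theorem Covered.of_isCompact {α β c d : ℝ} {K : Set ℝ} (hK : IsCompact K)
    (h : ∀ κ ∈ K, ∃ U ∈ 𝓝 κ, Covered α β c d U) : Covered α β c d K := by
  refine hK.induction_on (p := Covered α β c d) ⟨[], by simp, 0, by simp⟩
    (fun s t hst ht => ht.mono hst) (fun s t hs ht => hs.union ht) fun κ hκ => ?_
  obtain ⟨U, hU, hcov⟩ := h κ hκ
  exact ⟨U, mem_nhdsWithin_of_mem_nhds hU, hcov⟩

theorem continuousAt_klBernoulli_right {q p : ℝ} (hq0 : 0 < q) (hq1 : q < 1) (hp0 : 0 < p)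
    (hp1 : p < 1) : ContinuousAt (fun x => klBernoulli q x) p := by
  have hq1' : 1 - q ≠ 0 := (sub_pos.2 hq1).ne'
  have hp1' : 1 - p ≠ 0 := (sub_pos.2 hp1).ne'
  unfold klBernoulli
  have h1 : ContinuousAt (fun x : ℝ => q / x) p := continuousAt_const.div continuousAt_id hp0.ne'
  have h2 : ContinuousAt (fun x : ℝ => (1 - q) / (1 - x)) p :=
    continuousAt_const.div (continuousAt_const.sub continuousAt_id) hp1'
  exact (continuousAt_const.mul (h1.log (div_ne_zero hq0.ne' hp0.ne'))).add
    (continuousAt_const.mul (h2.log (div_ne_zero hq1' hp1')))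

/-- Strict inequalities at `κ` give a strategy for a neighbourhood of `κ`. -/
theorem exists_covered_nhds {α β c d p q₁ q₂ v κ : ℝ} (hα : 0 ≤ α) (hc : 1 < c) (hd : 1 < d)
    (hv : 0 ≤ v) (hp : p ∈ Set.Ioo 0 1) (hq₁ : q₁ ∈ Set.Ioo 0 1) (hq₂ : q₂ ∈ Set.Ioo 0 1)
    (hlen : κ * (1 - q₁) < v) (hsize : κ * q₁ + (1 - κ) * q₂ + α * v < β * κ)
    (hrate : v * Real.log c + κ * klBernoulli q₁ p + (1 - κ) * klBernoulli q₂ p < Real.log d) :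
    ∃ U ∈ 𝓝 κ, Covered α β c d U := by
  have hcont : ContinuousAt (fun x => v * Real.log c + κ * klBernoulli q₁ x +
      (1 - κ) * klBernoulli q₂ x) p :=
    (continuousAt_const.add (continuousAt_const.mul
      (continuousAt_klBernoulli_right hq₁.1 hq₁.2 hp.1 hp.2))).add (continuousAt_const.mul
      (continuousAt_klBernoulli_right hq₂.1 hq₂.2 hp.1 hp.2))
  -- The strict rate inequality survives a small change of `p`, so `p` may be replaced by a dyadic
  -- number, as the coins require.
  obtain ⟨δ, hδ, hball⟩ := Metric.eventually_nhds_iff.1 (hcont.eventually_lt_const hrate)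
  obtain ⟨w, b, hw0, hw1, hwb⟩ := exists_dyadic_near hp.1 hp.2 hδ
  have hrate' := hball (show dist (w / 2 ^ b : ℝ) p < δ from hwb)
  obtain ⟨ε₁, h1, h1'⟩ := exists_between (sub_pos.2 hlen)
  obtain ⟨ε₂, h2, h2'⟩ := exists_between (sub_pos.2 hsize)
  obtain ⟨ε₃, h3, h3'⟩ := exists_between (sub_pos.2 hrate')
  set ε := min ε₁ (min ε₂ ε₃) with hε
  have e1 : ε ≤ ε₁ := min_le_left _ _
  have e2 : ε ≤ ε₂ := (min_le_right _ _).trans (min_le_left _ _)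
  have e3 : ε ≤ ε₃ := (min_le_right _ _).trans (min_le_right _ _)
  refine ⟨_, ?_, covered_slack hα hc hd hv (lt_min h1 (lt_min h2 h3) : 0 < ε) hw0 hw1 hq₁ hq₂⟩
  have c1 : ∀ᶠ x in 𝓝 κ, x * (1 - q₁) + ε < v :=
    Continuous.tendsto (f := fun x : ℝ => x * (1 - q₁) + ε) (by fun_prop) κ
      |>.eventually_lt_const (by linarith)
  have c2 : ∀ᶠ x in 𝓝 κ, x * q₁ + (1 - x) * q₂ + α * v + ε - β * x < 0 :=
    Continuous.tendsto (f := fun x : ℝ => x * q₁ + (1 - x) * q₂ + α * v + ε - β * x)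
      (by fun_prop) κ |>.eventually_lt_const (by linarith)
  have c3 : ∀ᶠ x in 𝓝 κ, v * Real.log c + x * klBernoulli q₁ (w / 2 ^ b) +
      (1 - x) * klBernoulli q₂ (w / 2 ^ b) + ε < Real.log d :=
    Continuous.tendsto (f := fun x : ℝ => v * Real.log c + x * klBernoulli q₁ (w / 2 ^ b) +
      (1 - x) * klBernoulli q₂ (w / 2 ^ b) + ε) (by fun_prop) κ
      |>.eventually_lt_const (by linarith)
  filter_upwards [c1, c2, c3] with x hx1 hx2 hx3
  exact ⟨hx1, by linarith, hx3⟩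

/-! ### Monotonicity of the divergence in each argument. -/

theorem klBernoulli_self (p : ℝ) (h0 : 0 < p) (h1 : p < 1) : klBernoulli p p = 0 := by
  have : 1 - p ≠ 0 := (sub_pos.2 h1).ne'
  simp [klBernoulli, div_self h0.ne', div_self this]

theorem klBernoulli_sub_right (a x y : ℝ) (ha0 : 0 < a) (ha1 : a < 1) (hx0 : 0 < x) (hx1 : x < 1)
    (hy0 : 0 < y) (hy1 : y < 1) : klBernoulli a x - klBernoulli a y =
      a * Real.log (y / x) + (1 - a) * Real.log ((1 - y) / (1 - x)) := by
  have ha : 1 - a ≠ 0 := (sub_pos.2 ha1).ne'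
  have hx : 1 - x ≠ 0 := (sub_pos.2 hx1).ne'
  have hy : 1 - y ≠ 0 := (sub_pos.2 hy1).ne'
  unfold klBernoulli
  rw [Real.log_div ha0.ne' hx0.ne', Real.log_div ha0.ne' hy0.ne', Real.log_div ha hx,
    Real.log_div ha hy, Real.log_div hy0.ne' hx0.ne', Real.log_div hy hx]
  ring

/-- Applying `log z ≥ 1 - 1 / z` to both terms of the difference leaves `(y - x) * (a - y) / (y * (1
- y)) ≥ 0`, and the inequality is strict in the first term. -/
theorem klBernoulli_strictAnti_right {a x y : ℝ} (ha1 : a < 1) (hx0 : 0 < x)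
    (hxy : x < y) (hya : y ≤ a) : klBernoulli a y < klBernoulli a x := by
  have hy0 := hx0.trans hxy
  have ha0 := hy0.trans_le hya
  have hy1 := hya.trans_lt ha1
  have hx1 := hxy.trans hy1
  have h := klBernoulli_sub_right a x y ha0 ha1 hx0 hx1 hy0 hy1
  have hx : 0 < 1 - x := sub_pos.2 hx1
  have hy : 0 < 1 - y := sub_pos.2 hy1
  have ha : 0 < 1 - a := sub_pos.2 ha1
  have l1 : 1 - (y / x)⁻¹ < Real.log (y / x) := by
    have h0 : 0 < x / y := by positivity
    have hne : x / y ≠ 1 := ((div_lt_one hy0).2 hxy).ne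
    have := Real.log_lt_sub_one_of_pos h0 hne
    rw [← inv_div y x, Real.log_inv] at this
    linarith
  have l2 := Real.one_sub_inv_le_log_of_pos (show 0 < (1 - y) / (1 - x) by positivity)
  have l1' := mul_lt_mul_of_pos_left l1 ha0
  have l2' := mul_le_mul_of_nonneg_left l2 ha.le
  have e : a * (1 - (y / x)⁻¹) + (1 - a) * (1 - ((1 - y) / (1 - x))⁻¹) =
      (y - x) * (a - y) / (y * (1 - y)) := by
    field_simp; ring
  have : 0 ≤ (y - x) * (a - y) / (y * (1 - y)) :=
    div_nonneg (mul_nonneg (by linarith) (by linarith)) (by positivity)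
  linarith

/-- Three-point identity: the difference is `klBernoulli x y`, which is positive, plus `y - x` times
logarithms that are nonnegative because `y ≤ p`. -/
theorem klBernoulli_strictAnti_left {x y p : ℝ} (hp1 : p < 1) (hx0 : 0 < x)
    (hxy : x < y) (hyp : y ≤ p) : klBernoulli y p < klBernoulli x p := by
  have hy0 := hx0.trans hxy
  have hp0 := hy0.trans_le hyp
  have hy1 := hyp.trans_lt hp1
  have hx1 := hxy.trans hy1
  have hx : 0 < 1 - x := sub_pos.2 hx1
  have hy : 0 < 1 - y := sub_pos.2 hy1
  have hp : 0 < 1 - p := sub_pos.2 hp1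
  have e : klBernoulli x p - klBernoulli y p = klBernoulli x y +
      (y - x) * (Real.log (p / y) + Real.log ((1 - y) / (1 - p))) := by
    unfold klBernoulli
    rw [Real.log_div hx0.ne' hp0.ne', Real.log_div hx.ne' hp.ne', Real.log_div hy0.ne' hp0.ne',
      Real.log_div hy.ne' hp.ne', Real.log_div hx0.ne' hy0.ne', Real.log_div hx.ne' hy.ne',
      Real.log_div hp0.ne' hy0.ne']
    ring
  have h2 : 0 < klBernoulli x y := by
    have l1 : 1 - (x / y)⁻¹ < Real.log (x / y) := by
      have h0 : 0 < y / x := by positivity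
      have hne : y / x ≠ 1 := ((one_lt_div hx0).2 hxy).ne'
      have := Real.log_lt_sub_one_of_pos h0 hne
      rw [← inv_div x y, Real.log_inv] at this
      linarith
    have l2 := Real.one_sub_inv_le_log_of_pos (show 0 < (1 - x) / (1 - y) by positivity)
    have l1' := mul_lt_mul_of_pos_left l1 hx0
    have l2' := mul_le_mul_of_nonneg_left l2 hx.le
    have e : x * (1 - (x / y)⁻¹) + (1 - x) * (1 - ((1 - x) / (1 - y))⁻¹) = 0 := by
      field_simp; ring
    unfold klBernoulli
    linarith
  have h3 : 0 ≤ Real.log (p / y) := Real.log_nonneg ((one_le_div hy0).2 hyp)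
  have h4 : 0 ≤ Real.log ((1 - y) / (1 - p)) :=
    Real.log_nonneg ((one_le_div hp).2 (by linarith))
  have h5 := mul_nonneg (sub_nonneg.2 hxy.le) (add_nonneg h3 h4)
  linarith

/-! ### Strategies near a given proportion; the rate inequality. -/

/-- Sample all but a small proportion `t` of the elements. A typical sample is wanted, so both
divergences vanish and the rate `t * s * log c` is as small as desired. -/
theorem exists_covered_nhds_of_eq {α β c d : ℝ} (hα : 1 ≤ α) (hαβ : α < β) (hc : 1 < c)
    (hd : 1 < d) : ∃ U ∈ 𝓝 (1 / β), Covered α β c d U := by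
  have hβ : 0 < β := by linarith
  have hα0 : 0 < α := by linarith
  -- Length `t * s` exceeds the missing proportion `t / β` of the solution if `s > 1 / β`, and the
  -- size `1 - t + α * t * s` is below 1 if `s < 1 / α`.
  obtain ⟨s, hs1, hs2⟩ := exists_between (one_div_lt_one_div_of_lt hα0 hαβ)
  have hs0 : 0 < s := lt_trans (by positivity) hs1
  have hlc : 0 < Real.log c := Real.log_pos hc
  have hld : 0 < Real.log d := Real.log_pos hd
  obtain ⟨t, ht0, ht⟩ := exists_between (lt_min one_pos (show 0 < Real.log d / (s * Real.log c) by
    positivity))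
  have ht1 := ht.trans_le (min_le_left _ _)
  have ht2 := ht.trans_le (min_le_right _ _)
  rw [lt_div_iff₀ (by positivity)] at ht2
  have hq : 1 - t ∈ Set.Ioo (0 : ℝ) 1 := ⟨by linarith, by linarith⟩
  refine exists_covered_nhds (p := 1 - t) (q₁ := 1 - t) (q₂ := 1 - t) (v := t * s) (by linarith)
    hc hd (by positivity) hq hq hq ?_ ?_ ?_
  · have := mul_lt_mul_of_pos_right hs1 ht0
    linarith
  · rw [lt_div_iff₀ hα0] at hs2
    have e : β * (1 / β) = 1 := by field_simp
    rw [e]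
    have := mul_lt_mul_of_pos_right hs2 ht0
    linarith
  · rw [klBernoulli_self _ hq.1 hq.2]
    linarith

/-- The exponent of the cost when the solution has a proportion `t a + (1 - t) u` of the elements
and the sample, a proportion `t`, meets it in a proportion `t a`. -/
theorem rate_le {a u c t κ : ℝ} (hc : 1 < c) (hu0 : 0 < u) (hua : u < a) (ha1 : a < 1)
    (hkl : klBernoulli a u = a * Real.log c) (ht0 : 0 < t) (ht1 : t < 1)
    (hκ : κ = t * a + (1 - t) * u) :
    u * (1 - t) * Real.log c + κ * klBernoulli (t * a / κ) t +
      (1 - κ) * klBernoulli (t * (1 - a) / (1 - κ)) t ≤ Real.log (1 + (c - 1) * u) := by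
  have ha0 : 0 < a := hu0.trans hua
  have hu1 : u < 1 := hua.trans ha1
  have ha1' : 0 < 1 - a := sub_pos.2 ha1
  have hu1' : 0 < 1 - u := sub_pos.2 hu1
  have ht1' : 0 < 1 - t := sub_pos.2 ht1
  have hκ0 : 0 < κ := by rw [hκ]; positivity
  have hκ1 : 1 - κ = t * (1 - a) + (1 - t) * (1 - u) := by rw [hκ]; ring
  have hκ1' : 0 < 1 - κ := by rw [hκ1]; positivity
  have hc0 : 0 < c := by linarith
  have hd : 0 < 1 + (c - 1) * u := by nlinarith
  have e1 : κ * klBernoulli (t * a / κ) t =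
      t * a * (Real.log a - Real.log κ) + (1 - t) * u * (Real.log u - Real.log κ) := by
    have q : 1 - t * a / κ = (1 - t) * u / κ := by rw [hκ]; field_simp; ring
    have r : t * a / κ / t = a / κ := by field_simp
    have r' : (1 - t) * u / κ / (1 - t) = u / κ := by field_simp
    rw [klBernoulli, q, r, r', Real.log_div ha0.ne' hκ0.ne', Real.log_div hu0.ne' hκ0.ne']
    field_simp
  have e2 : (1 - κ) * klBernoulli (t * (1 - a) / (1 - κ)) t =
      t * (1 - a) * (Real.log (1 - a) - Real.log (1 - κ)) +
        (1 - t) * (1 - u) * (Real.log (1 - u) - Real.log (1 - κ)) := by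
    have q : 1 - t * (1 - a) / (1 - κ) = (1 - t) * (1 - u) / (1 - κ) := by
      rw [eq_div_iff hκ1'.ne', sub_mul, div_mul_cancel₀ _ hκ1'.ne', one_mul]
      linarith
    have r : t * (1 - a) / (1 - κ) / t = (1 - a) / (1 - κ) := by field_simp
    have r' : (1 - t) * (1 - u) / (1 - κ) / (1 - t) = (1 - u) / (1 - κ) := by field_simp
    rw [klBernoulli, q, r, r', Real.log_div ha1'.ne' hκ1'.ne', Real.log_div hu1'.ne' hκ1'.ne']
    field_simp
  have e3 : a * (Real.log a - Real.log u) + (1 - a) * (Real.log (1 - a) - Real.log (1 - u)) =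
      a * Real.log c := by
    rw [← hkl, klBernoulli, Real.log_div ha0.ne' hu0.ne', Real.log_div ha1'.ne' hu1'.ne']
  -- Gibbs' inequality for `(κ, 1 - κ)` against `(c * u / d, (1 - u) / d)`, which sums to 1 for `d =
  -- 1 + (c - 1) * u`.
  have l1 := Real.log_le_sub_one_of_pos (show 0 < c * u / (κ * (1 + (c - 1) * u)) by positivity)
  have l2 := Real.log_le_sub_one_of_pos (show 0 < (1 - u) / ((1 - κ) * (1 + (c - 1) * u)) by
    positivity)
  rw [Real.log_div (by positivity) (by positivity), Real.log_mul hc0.ne' hu0.ne',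
    Real.log_mul hκ0.ne' hd.ne'] at l1
  rw [Real.log_div (by positivity) (by positivity), Real.log_mul hκ1'.ne' hd.ne'] at l2
  have l1' := mul_le_mul_of_nonneg_left l1 hκ0.le
  have l2' := mul_le_mul_of_nonneg_left l2 hκ1'.le
  have e4 : κ * (c * u / (κ * (1 + (c - 1) * u)) - 1) +
      (1 - κ) * ((1 - u) / ((1 - κ) * (1 + (c - 1) * u)) - 1) = 0 := by
    have r1 : κ * (c * u / (κ * (1 + (c - 1) * u))) = c * u / (1 + (c - 1) * u) := by field_simp
    have r2 : (1 - κ) * ((1 - u) / ((1 - κ) * (1 + (c - 1) * u))) =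
      (1 - u) / (1 + (c - 1) * u) := by field_simp
    rw [mul_sub, mul_sub, r1, r2]
    have : c * u / (1 + (c - 1) * u) + (1 - u) / (1 + (c - 1) * u) = 1 := by
      rw [← add_div, div_eq_one_iff_eq hd.ne']; ring
    linarith
  -- Substituting `e3` with weight `t` replaces the entropy terms in `a` by logarithms of `u` and `1
  -- - u`, so that `t` enters only through `κ`.
  have e5 : u * (1 - t) * Real.log c + κ * klBernoulli (t * a / κ) t +
      (1 - κ) * klBernoulli (t * (1 - a) / (1 - κ)) t =
      κ * (Real.log c + Real.log u - Real.log κ) +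
        (1 - κ) * (Real.log (1 - u) - Real.log (1 - κ)) := by
    rw [e1, e2, hκ1]
    rw [hκ] at *
    linear_combination t * e3
  rw [e5]
  linarith

/-- This is where `α < β` improves on the benchmark: the parameters of `rate_le` leave `(β - α) *
v₀` of the size bound unused, and spending part of it on `q₂` lowers the rate strictly. -/
theorem exists_covered_nhds_of_mem_Ioo {α β c u κ : ℝ} (hα : 1 ≤ α) (hαβ : α < β) (hc : 1 < c)
    (hu0 : 0 < u) (hkl : klBernoulli (1 / β) u = 1 / β * Real.log c)
    (hκ : κ ∈ Set.Ioo u (1 / β)) :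
    ∃ U ∈ 𝓝 κ, Covered α β c (1 + (c - 1) * u) U := by
  have hβ : 1 < β := by linarith
  have hβ0 : 0 < β := by linarith
  set a := 1 / β with ha
  have hβa : β * a = 1 := by rw [ha]; field_simp
  have ha1 : a < 1 := by rw [ha, div_lt_one hβ0]; exact hβ
  obtain ⟨huκ, hκa⟩ := hκ
  have hua := huκ.trans hκa
  have ha0 : 0 < a := hu0.trans hua
  have hu1 : u < 1 := hua.trans ha1
  have hau : 0 < a - u := sub_pos.2 hua
  have ha1' : 0 < 1 - a := sub_pos.2 ha1
  have hu1' : 0 < 1 - u := sub_pos.2 hu1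
  have hκ0 : 0 < κ := hu0.trans huκ
  have hκ1' : 0 < 1 - κ := by linarith
  set t := (κ - u) / (a - u) with ht
  have ht0 : 0 < t := div_pos (sub_pos.2 huκ) hau
  have ht1 : t < 1 := by rw [ht, div_lt_one hau]; linarith
  have ht1' : 0 < 1 - t := sub_pos.2 ht1
  have hκt : κ = t * a + (1 - t) * u := by
    have : t * (a - u) = κ - u := div_mul_cancel₀ _ hau.ne'
    linarith
  have hrate := rate_le hc hu0 hua ha1 hkl ht0 ht1 hκt
  set q₁ := t * a / κ with hq₁
  set q₂ := t * (1 - a) / (1 - κ) with hq₂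
  have eq₁ : κ * q₁ = t * a := by rw [hq₁]; field_simp
  have eq₂ : (1 - κ) * q₂ = t * (1 - a) := by rw [hq₂]; field_simp
  have hq₁' : q₁ ∈ Set.Ioo (0 : ℝ) 1 := by
    refine ⟨by positivity, ?_⟩
    rw [hq₁, div_lt_one hκ0, hκt]
    have : 0 < (1 - t) * u := by positivity
    linarith
  have hq₂0 : 0 < q₂ := by positivity
  have hq₂t : q₂ < t := by
    rw [hq₂, div_lt_iff₀ hκ1']
    exact mul_lt_mul_of_pos_left (by linarith) ht0
  set v₀ := u * (1 - t) with hv₀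
  have hv₀0 : 0 < v₀ := by positivity
  have hlc : 0 < Real.log c := Real.log_pos hc
  have hsize : κ * q₁ + (1 - κ) * q₂ + α * v₀ < β * κ := by
    have e : β * κ = t + β * v₀ := by
      rw [hκt, hv₀]
      linear_combination t * hβa
    rw [eq₁, eq₂, e]
    have := mul_lt_mul_of_pos_right hαβ hv₀0
    linarith
  -- Choosing more elements outside of the solution is possible and makes the sample more likely.
  have hev : ∀ᶠ x in 𝓝[>] q₂, κ * q₁ + (1 - κ) * x + α * v₀ < β * κ :=
    (Continuous.tendsto (f := fun x : ℝ => κ * q₁ + (1 - κ) * x + α * v₀) (by fun_prop) q₂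
      |>.eventually_lt_const hsize).filter_mono nhdsWithin_le_nhds
  obtain ⟨q, hqsize, hq₂q, hqt⟩ := (hev.and (Ioo_mem_nhdsGT hq₂t)).exists
  have hrate' : v₀ * Real.log c + κ * klBernoulli q₁ t + (1 - κ) * klBernoulli q t <
      Real.log (1 + (c - 1) * u) := by
    have := mul_lt_mul_of_pos_left (klBernoulli_strictAnti_left ht1 hq₂0 hq₂q hqt.le) hκ1'
    linarith
  -- At `v₀` the length condition is an equality, so the length is increased slightly at the expense
  -- of the other two.
  have hev' : ∀ᶠ v in 𝓝[>] v₀, κ * q₁ + (1 - κ) * q + α * v < β * κ :=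
    (Continuous.tendsto (f := fun v : ℝ => κ * q₁ + (1 - κ) * q + α * v) (by fun_prop) v₀
      |>.eventually_lt_const hqsize).filter_mono nhdsWithin_le_nhds
  have hev'' : ∀ᶠ v in 𝓝[>] v₀, v * Real.log c + κ * klBernoulli q₁ t +
      (1 - κ) * klBernoulli q t < Real.log (1 + (c - 1) * u) :=
    (Continuous.tendsto (f := fun v : ℝ => v * Real.log c + κ * klBernoulli q₁ t +
      (1 - κ) * klBernoulli q t) (by fun_prop) v₀
      |>.eventually_lt_const hrate').filter_mono nhdsWithin_le_nhds
  obtain ⟨v, ⟨hvsize, hvrate⟩, hv⟩ := ((hev'.and hev'').and self_mem_nhdsWithin).exists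
  have hv' : v₀ < v := hv
  refine exists_covered_nhds (by linarith) hc (by nlinarith) (by linarith) ⟨ht0, ht1⟩ hq₁'
    ⟨hq₂0.trans hq₂q, hqt.trans ht1⟩ ?_ hvsize hvrate
  rw [mul_sub, eq₁, hκt]
  linarith

/-! ### Small solutions, small universes, and the finite list of strategies. -/

/-- Strict Bernoulli inequality `c ^ u < 1 + (c - 1) * u`. -/
theorem log_mul_lt {c u : ℝ} (hc : 1 < c) (hu0 : 0 < u) (hu1 : u < 1) :
    u * Real.log c < Real.log (1 + (c - 1) * u) := by
  have h := rpow_one_add_lt_one_add_mul_self (s := c - 1) (by linarith) (by linarith) hu0 hu1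
  rw [add_sub_cancel] at h
  have hc0 : 0 < c := by linarith
  rw [← Real.log_rpow hc0]
  refine Real.log_lt_log (Real.rpow_pos_of_pos hc0 u) ?_
  linarith

/-- Small solutions are found by extending the empty set. -/
theorem exists_small_strategy {α β c d u : ℝ} (hαβ : α ≤ β) (hc : 1 < c) (hd : 1 < d)
    (hu0 : 0 < u) (hu : u * Real.log c < Real.log d) :
    ∃ (r : ℝ) (S : Strategy), u < r ∧ 2 ^ S.e * c ^ S.f < d ^ S.m ∧
      ∀ n k : ℕ, (k : ℝ) ≤ r * n → S.Works α β n k := by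
  have hlc : 0 < Real.log c := Real.log_pos hc
  obtain ⟨r, hr1, hr2⟩ := exists_rat_btwn ((lt_div_iff₀ hlc).2 hu)
  rw [lt_div_iff₀ hlc] at hr2
  have hr0 : 0 < r := by
    have : (0 : ℝ) < r := hu0.trans hr1
    exact_mod_cast this
  have hden : (0 : ℝ) < r.den := Nat.cast_pos.2 r.den_pos
  have hnum : ((r.num.toNat : ℕ) : ℝ) = r * r.den := by
    have h1 : ((r.num.toNat : ℕ) : ℤ) = r.num := Int.toNat_of_nonneg (Rat.num_pos.2 hr0).le
    have h2 : (r.num : ℚ) = r * r.den := (Rat.mul_den_eq_num r).symm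
    have h3 : ((r.num.toNat : ℕ) : ℚ) = r * r.den := by rw [← h2]; exact_mod_cast h1
    exact_mod_cast h3
  -- Sampling probability 0 gives the empty set, so two trials suffice, and `f / m = r`, rational
  -- for this purpose, bounds the lengths.
  refine ⟨r, ⟨0, 0, r.den, 0, r.num.toNat, 1, by simp, r.den_pos⟩, hr1, ?_, fun n k hk => ?_⟩
  · have hc0 : 0 < c := by linarith
    rw [pow_zero, one_mul, ← Real.log_lt_log_iff (by positivity) (by positivity), Real.log_pow,
      Real.log_pow, hnum]
    have := mul_lt_mul_of_pos_right hr2 hden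
    linarith
  · set S : Strategy := ⟨0, 0, r.den, 0, r.num.toNat, 1, by simp, r.den_pos⟩ with hS
    have hp : S.prob = 0 := by simp [Strategy.prob, hS]
    have hreps : S.reps n = 2 := by simp [Strategy.reps, hS]
    refine ⟨k, 0, 0, ?_, by omega, ?_, ?_⟩
    · have hb : (n : ℝ) ≤ r.den * S.blocks n := by exact_mod_cast S.le_blocks n
      have hr0' : (0 : ℝ) ≤ r := by exact_mod_cast hr0.le
      have : (k : ℝ) ≤ S.maxLen n := by
        rw [Strategy.maxLen, Nat.cast_mul]
        change (k : ℝ) ≤ (r.num.toNat : ℕ) * (S.blocks n : ℝ)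
        rw [hnum, mul_assoc]
        exact hk.trans (mul_le_mul_of_nonneg_left hb hr0')
      exact_mod_cast this
    · have := mul_le_mul_of_nonneg_right hαβ (Nat.cast_nonneg (α := ℝ) k)
      simpa using this
    · rw [hp, hreps]; simp

/-- Instances of bounded size are solved by random guessing. -/
theorem exists_bounded_strategy {c d β : ℝ} (α : ℝ) (hβ : 1 ≤ β) (hd : 1 < d) (n₀ : ℕ) :
    ∃ S : Strategy, 2 ^ S.e * c ^ S.f < d ^ S.m ∧
      ∀ n k : ℕ, n ≤ n₀ → k ≤ n → S.Works α β n k := by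
  -- A uniformly random set is the solution itself with probability at least `2⁻¹ ^ n₀`; with `2 ^
  -- (n₀ + 1)` trials and length 0 the number of trials does not grow with `n`.
  refine ⟨⟨1, 1, 1, 0, 0, n₀ + 1, by norm_num, one_pos⟩, by simpa using hd, fun n k hn hk => ?_⟩
  set S : Strategy := ⟨1, 1, 1, 0, 0, n₀ + 1, by norm_num, one_pos⟩ with hS
  have hp : S.prob = 1 / 2 := by simp [Strategy.prob, hS]
  have hreps : S.reps n = 2 ^ (n₀ + 1) := by simp [Strategy.reps, hS]
  refine ⟨0, k, 0, Nat.zero_le _, by omega, ?_, ?_⟩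
  · have := mul_le_mul_of_nonneg_right hβ (Nat.cast_nonneg (α := ℝ) k)
    simpa using this
  · have h : (1 - 1 / 2 : ℝ) = 1 / 2 := by norm_num
    rw [hp, hreps, h, ← pow_add, show k + 0 + (n - (k + 0)) = n by omega]
    simp only [Nat.choose_self, Nat.choose_zero_right, Nat.cast_one, one_mul, one_div, inv_pow]
    rw [Nat.cast_pow, Nat.cast_ofNat, ← div_eq_mul_inv, le_div_iff₀ (by positivity), pow_succ,
      mul_comm]
    exact mul_le_mul_of_nonneg_right (pow_le_pow_right₀ (by norm_num) hn) (by norm_num)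

/-- Finitely many strategies of cost less than `d ^ n` solve all instances. -/
theorem exists_strategies {α β c u : ℝ} (hα : 1 ≤ α) (hαβ : α < β) (hc : 1 < c) (hu0 : 0 < u)
    (hua : u < 1 / β) (hkl : klBernoulli (1 / β) u = 1 / β * Real.log c) :
    ∃ l : List Strategy, (∀ S ∈ l, 2 ^ S.e * c ^ S.f < (1 + (c - 1) * u) ^ S.m) ∧
      ∀ n k : ℕ, k ≤ n → (n : ℝ) ≤ β * k ∨ ∃ S ∈ l, S.Works α β n k := by
  have hβ0 : 0 < β := by linarith
  have hβ1 : 1 < β := by linarith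
  have hu1 : u < 1 := hua.trans (by rw [div_lt_one hβ0]; exact hβ1)
  have hd : 1 < 1 + (c - 1) * u := by nlinarith
  obtain ⟨r, S₀, hr, hS₀, hW₀⟩ := exists_small_strategy hαβ.le hc hd hu0 (log_mul_lt hc hu0 hu1)
  have hcov : Covered α β c (1 + (c - 1) * u) (Set.Icc r (1 / β)) := by
    refine Covered.of_isCompact isCompact_Icc fun κ hκ => ?_
    rcases hκ.2.eq_or_lt with h | h
    · rw [h]
      exact exists_covered_nhds_of_eq hα hαβ hc hd
    · exact exists_covered_nhds_of_mem_Ioo hα hαβ hc hu0 hkl ⟨hr.trans_le hκ.1, h⟩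
  obtain ⟨l, hl, n₀, hn₀⟩ := hcov
  obtain ⟨S₁, hS₁, hW₁⟩ := exists_bounded_strategy (c := c) α hβ1.le hd n₀
  refine ⟨S₀ :: S₁ :: l, ?_, fun n k hk => ?_⟩
  · intro S hS
    rcases List.mem_cons.1 hS with rfl | hS
    · exact hS₀
    rcases List.mem_cons.1 hS with rfl | hS
    · exact hS₁
    · exact hl S hS
  · rcases le_total n n₀ with hn | hn
    · exact Or.inr ⟨S₁, by simp, hW₁ n k hn hk⟩
    rcases Nat.eq_zero_or_pos n with rfl | hpos
    · exact Or.inl (by push_cast; positivity)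
    have hnR : (0 : ℝ) < n := Nat.cast_pos.2 hpos
    rcases le_total (k : ℝ) (r * n) with h1 | h1
    · exact Or.inr ⟨S₀, by simp, hW₀ n k h1⟩
    rcases le_total (n : ℝ) (β * k) with h2 | h2
    · exact Or.inl h2
    · obtain ⟨S, hS, hW⟩ := hn₀ n hn hpos k hk
        ⟨(le_div_iff₀ hnR).2 h1, by rw [div_le_div_iff₀ hnR hβ0]; linarith⟩
      exact Or.inr ⟨S, by simp [hS], hW⟩

/-! ### The exponential base of the cost. -/

theorem Strategy.cost_le (S : Strategy) {c d : ℝ} (hc : 1 < c) (hd : 1 < d)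
    (hS : 2 ^ S.e * c ^ S.f < d ^ S.m) :
    ∃ D : ℝ, 1 ≤ D ∧ D < d ∧ ∃ C : ℝ, 0 ≤ C ∧ ∀ n : ℕ, S.cost c n ≤ D ^ n * (C * (n + 1) ^ 2) := by
  have hm := S.m_pos
  have hc0 : 0 < c := by linarith
  have hE : (1 : ℝ) ≤ 2 ^ S.e * c ^ S.f :=
    one_le_mul_of_one_le_of_one_le (one_le_pow₀ (by norm_num)) (one_le_pow₀ hc.le)
  -- A block of `m` elements contributes the factor `2 ^ e * c ^ f = D ^ m`.
  set D : ℝ := (2 ^ S.e * c ^ S.f) ^ ((S.m : ℝ)⁻¹) with hD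
  have hDm : D ^ S.m = 2 ^ S.e * c ^ S.f :=
    Real.rpow_inv_natCast_pow (by positivity) hm.ne'
  have hD1 : 1 ≤ D := Real.one_le_rpow hE (by positivity)
  have hDd : D < d := lt_of_pow_lt_pow_left₀ S.m (by linarith) (hDm.trans_lt hS)
  -- The factor `D ^ m` covers the last, incomplete block.
  set A : ℝ := 2 ^ S.a * D ^ S.m with hA
  have hA0 : 0 ≤ A := by positivity
  refine ⟨D, hD1, hDd, (S.f + 1) * ((2 * S.b + 19) * A + 4) + (3 * S.e + 3 * S.a + 15),
    by positivity, fun n => ?_⟩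
  have hblocks : S.blocks n ≤ n + 1 := by
    have h1 := S.blocks_lt n
    have h2 : n ≤ S.m * n := Nat.le_mul_of_pos_left n hm
    refine Nat.le_of_mul_le_mul_left ?_ hm
    rw [Nat.mul_succ]
    omega
  have hn1 : (1 : ℝ) ≤ n + 1 := by have := Nat.cast_nonneg (α := ℝ) n; linarith
  have hDn : 1 ≤ D ^ n := one_le_pow₀ hD1
  have hprod : (S.reps n : ℝ) * c ^ S.maxLen n ≤ A * D ^ n := by
    calc (S.reps n : ℝ) * c ^ S.maxLen n = 2 ^ S.a * D ^ (S.m * S.blocks n) := by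
          rw [pow_mul, hDm, Strategy.reps, Strategy.maxLen, mul_pow, ← pow_mul, ← pow_mul]
          push_cast
          rw [pow_add]
          ring
      _ ≤ 2 ^ S.a * D ^ (n + S.m) :=
        mul_le_mul_of_nonneg_left (pow_le_pow_right₀ hD1 (S.blocks_lt n).le) (by positivity)
      _ = A * D ^ n := by rw [hA, pow_add]; ring
  have hreps : (S.reps n : ℝ) ≤ A * D ^ n :=
    (le_mul_of_one_le_right (Nat.cast_nonneg _) (one_le_pow₀ hc.le)).trans hprod
  have hbR : (S.blocks n : ℝ) ≤ n + 1 := by exact_mod_cast hblocks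
  have hmax : (S.maxLen n : ℝ) + 1 ≤ (S.f + 1) * (n + 1) := by
    rw [Strategy.maxLen, Nat.cast_mul]
    have := mul_le_mul_of_nonneg_left hbR (Nat.cast_nonneg (α := ℝ) S.f)
    linarith
  have hAD : 0 ≤ A * D ^ n := by positivity
  have hround : roundCost c n S.b (S.maxLen n) (S.reps n) ≤
      ((2 * S.b + 19) * A + 4) * D ^ n * (n + 1) := by
    have h1 := mul_le_mul_of_nonneg_right hreps
      (show (0 : ℝ) ≤ (n + 1) * (2 * S.b + 16) + 2 by positivity)
    have h2 : A * D ^ n * 3 ≤ A * D ^ n * 3 * (n + 1) :=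
      le_mul_of_one_le_right (by positivity) hn1
    have h3 : 1 ≤ D ^ n * (n + 1) := one_le_mul_of_one_le_of_one_le hDn hn1
    unfold roundCost trialCost
    linarith
  have hrest : (4 * n + 3 * (S.e * S.blocks n + S.a : ℕ) + 11 : ℝ) ≤
      (3 * S.e + 3 * S.a + 15) * (n + 1) := by
    have h1 := mul_le_mul_of_nonneg_left hbR (Nat.cast_nonneg (α := ℝ) S.e)
    have h2 : (S.a : ℝ) ≤ S.a * (n + 1) := le_mul_of_one_le_right (Nat.cast_nonneg _) hn1
    push_cast
    linarith
  have hround0 : 0 ≤ roundCost c n S.b (S.maxLen n) (S.reps n) := by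
    unfold roundCost trialCost; positivity
  have hrest' : (3 * S.e + 3 * S.a + 15 : ℝ) * (n + 1) ≤
      (3 * S.e + 3 * S.a + 15) * (n + 1) * (D ^ n * (n + 1)) :=
    le_mul_of_one_le_right (by positivity) (one_le_mul_of_one_le_of_one_le hDn hn1)
  unfold Strategy.cost
  calc _ ≤ (S.f + 1) * (n + 1) * (((2 * S.b + 19) * A + 4) * D ^ n * (n + 1)) +
        (3 * S.e + 3 * S.a + 15) * (n + 1) * (D ^ n * (n + 1)) :=
        add_le_add (mul_le_mul hmax hround hround0 (by positivity)) (hrest.trans hrest')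
    _ = _ := by ring

theorem exists_cost_le {c d : ℝ} (hc : 1 < c) (hd : 1 < d) (l : List Strategy)
    (hl : ∀ S ∈ l, 2 ^ S.e * c ^ S.f < d ^ S.m) :
    ∃ D : ℝ, 1 ≤ D ∧ D < d ∧ ∃ C : ℝ, 0 ≤ C ∧
      ∀ n : ℕ, (l.map fun S => S.cost c n).sum ≤ D ^ n * (C * (n + 1) ^ 2) := by
  induction l with
  | nil => exact ⟨1, le_rfl, hd, 0, le_rfl, fun n => by simp⟩
  | cons S l ih =>
    obtain ⟨D, hD1, hDd, C, hC, h⟩ := ih fun S' hS' => hl S' (by simp [hS'])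
    obtain ⟨D', hD1', hDd', C', hC', h'⟩ := S.cost_le hc hd (hl S (by simp))
    refine ⟨max D D', hD1.trans (le_max_left _ _), max_lt hDd hDd', C + C', by positivity,
      fun n => ?_⟩
    have e : D ^ n ≤ max D D' ^ n := pow_le_pow_left₀ (by linarith) (le_max_left _ _) n
    have e' : D' ^ n ≤ max D D' ^ n := pow_le_pow_left₀ (by linarith) (le_max_right _ _) n
    have f := mul_le_mul_of_nonneg_right e (show 0 ≤ C * ((n : ℝ) + 1) ^ 2 by positivity)
    have f' := mul_le_mul_of_nonneg_right e' (show 0 ≤ C' * ((n : ℝ) + 1) ^ 2 by positivity)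
    rw [List.map_cons, List.sum_cons]
    have g := h n
    have g' := h' n
    linarith

theorem best_lt {α β c u : ℝ} (hα : 1 ≤ α) (hαβ : α < β) (hc : 1 < c) (hu0 : 0 < u)
    (hua : u < 1 / β) (hkl : klBernoulli (1 / β) u = 1 / β * Real.log c) :
    best α c β < ((1 + (c - 1) * u : ℝ) : EReal) := by
  have hd : 1 < 1 + (c - 1) * u := by nlinarith
  obtain ⟨l, hl, hW⟩ := exists_strategies hα hαβ hc hu0 hua hkl
  obtain ⟨D, hD1, hDd, C, hC, hcost⟩ := exists_cost_le hc hd l hl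
  -- The 4 absorbs the cost `3 * n + 4` of `setup`.
  obtain ⟨C', hC'⟩ := exists_nat_ge (C + 4)
  refine lt_of_le_of_lt (sInf_le ?_) (EReal.coe_lt_coe_iff.2 hDd)
  refine ⟨D, rfl, hD1, _, isApprox_algorithm (by linarith) hc.le l hW, C', 2,
    hasCost_algorithm hc.le l ?_ fun n => ?_⟩
  · intro n n' hn
    have hnR : (n : ℝ) ≤ n' := Nat.cast_le.2 hn
    have h1 := pow_le_pow_right₀ hD1 hn
    have h2 : ((n : ℝ) + 1) ^ 2 ≤ ((n' : ℝ) + 1) ^ 2 :=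
      pow_le_pow_left₀ (by positivity) (by linarith) 2
    exact mul_le_mul h1 (mul_le_mul_of_nonneg_left h2 (Nat.cast_nonneg _)) (by positivity)
      (by positivity)
  · have hn : (0 : ℝ) ≤ n := Nat.cast_nonneg n
    have hDn : 1 ≤ D ^ n := one_le_pow₀ hD1
    have h4 : (3 * n + 4 : ℝ) ≤ D ^ n * (4 * (n + 1) ^ 2) := by
      have : (3 * n + 4 : ℝ) ≤ 4 * (n + 1) ^ 2 := by nlinarith
      exact this.trans (le_mul_of_one_le_left (by positivity) hDn)
    have h5 : D ^ n * ((C + 4) * ((n : ℝ) + 1) ^ 2) ≤ D ^ n * (C' * ((n : ℝ) + 1) ^ 2) := by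
      gcongr
    have h6 := hcost n
    linarith

/-! ### The defining equation of the benchmark. -/

theorem exists_klBernoulli_eq {a y : ℝ} (ha0 : 0 < a) (ha1 : a < 1) (hy : 0 < y) :
    ∃ u ∈ Set.Ioo 0 a, klBernoulli a u = y := by
  have ha1' : 0 < 1 - a := sub_pos.2 ha1
  have hlog : Real.log (1 - a) < 0 := Real.log_neg ha1' (by linarith)
  -- At `u₀ = a * exp (-z)` the terms `a * z + (1 - a) * log (1 - a)` alone equal `y`, and the
  -- remaining `-(1 - a) * log (1 - u₀)` is nonnegative. So the intermediate value theorem applies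
  -- between `u₀` and `a`.
  set z := (y - (1 - a) * Real.log (1 - a)) / a with hz
  have hz0 : 0 < z := by
    refine div_pos ?_ ha0
    have := mul_pos ha1' (neg_pos.2 hlog)
    linarith
  set u₀ := a * Real.exp (-z) with hu₀
  have hu₀0 : 0 < u₀ := by positivity
  have hu₀a : u₀ < a := by
    have : Real.exp (-z) < 1 := by
      rw [← Real.exp_zero]; exact Real.exp_lt_exp.2 (by linarith)
    nlinarith
  have hbig : y ≤ klBernoulli a u₀ := by
    have e : a / u₀ = Real.exp z := by
      rw [hu₀, Real.exp_neg]; field_simp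
    have h1u : 0 < 1 - u₀ := by linarith
    have hl : Real.log (1 - u₀) ≤ 0 := Real.log_nonpos h1u.le (by linarith)
    rw [klBernoulli, e, Real.log_exp, Real.log_div ha1'.ne' h1u.ne']
    have haz : a * z = y - (1 - a) * Real.log (1 - a) := mul_div_cancel₀ _ ha0.ne'
    have := mul_nonneg ha1'.le (neg_nonneg.2 hl)
    linarith
  have hcont : ContinuousOn (fun x => klBernoulli a x) (Set.Icc u₀ a) := fun x hx =>
    (continuousAt_klBernoulli_right ha0 ha1 (hu₀0.trans_le hx.1)
      (hx.2.trans_lt ha1)).continuousWithinAt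
  obtain ⟨u, hu, huy⟩ := intermediate_value_Icc' hu₀a.le hcont
    ⟨by rw [klBernoulli_self a ha0 ha1]; exact hy.le, hbig⟩
  refine ⟨u, ⟨hu₀0.trans_le hu.1, lt_of_le_of_ne hu.2 ?_⟩, huy⟩
  rintro rfl
  simp only [klBernoulli_self u ha0 ha1] at huy
  exact hy.ne huy

/-- The substitution `u = (d - 1) / (c - 1)` is an increasing bijection, so existence and uniqueness
of `d` can be read off from `u`. -/
theorem isAmlsESA_iff {β c u : ℝ} (hc : 1 < c) :
    IsAmlsESA β c (1 + (c - 1) * u) ↔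
      u ∈ Set.Ioo 0 (1 / β) ∧ klBernoulli (1 / β) u = 1 / β * Real.log c := by
  have hc' : 0 < c - 1 := sub_pos.2 hc
  have e : (1 + (c - 1) * u - 1) / (c - 1) = u := by field_simp; ring
  have e' : 1 / β * Real.log c = Real.log c / β := by ring
  have e'' : 1 + (c - 1) / β = 1 + (c - 1) * (1 / β) := by ring
  rw [IsAmlsESA, e, e', e'']
  refine and_congr_left fun _ => and_congr ?_ ?_
  · rw [lt_add_iff_pos_right, mul_pos_iff_of_pos_left hc']
  · rw [add_lt_add_iff_left, mul_lt_mul_iff_right₀ hc']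

end SubsetMin

end

theorem lemma2p17 (α β c : ℝ) (hα : 1 ≤ α) (hαβ : α < β) (hc : 1 < c) :
    ∃ d : ℝ, SubsetMin.IsAmlsESA β c d ∧
      (∀ d' : ℝ, SubsetMin.IsAmlsESA β c d' → d' = d) ∧
      SubsetMin.best α c β < (d : EReal) := by
  open SubsetMin in
  have hβ1 : 1 < β := by linarith
  have hβ0 : 0 < β := by linarith
  have ha0 : 0 < 1 / β := by positivity
  have ha1 : 1 / β < 1 := by rw [div_lt_one hβ0]; exact hβ1
  have hlc : 0 < Real.log c := Real.log_pos hc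
  obtain ⟨u, hu, hkl⟩ := exists_klBernoulli_eq ha0 ha1 (mul_pos ha0 hlc)
  refine ⟨1 + (c - 1) * u, (isAmlsESA_iff hc).2 ⟨hu, hkl⟩, fun d' hd' => ?_,
    best_lt hα hαβ hc hu.1 hu.2 hkl⟩
  have hc' : c - 1 ≠ 0 := (sub_pos.2 hc).ne'
  obtain ⟨u', rfl⟩ : ∃ u', d' = 1 + (c - 1) * u' := ⟨(d' - 1) / (c - 1), by field_simp; ring⟩
  obtain ⟨hu', hkl'⟩ := (isAmlsESA_iff hc).1 hd'
  rcases lt_trichotomy u' u with h | h | h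
  · have := klBernoulli_strictAnti_right ha1 hu'.1 h hu.2.le
    linarith
  · rw [h]
  · have := klBernoulli_strictAnti_right ha1 hu.1 h hu'.2.le
    linarith
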